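/- Let $\sigma$ be a finite relational signature of unary and binary predicates containing a distinguished binary predicate $T$, and let $|\sigma|$ be its number of symbols. A *normal-form sentence with transitive witnesses* is $$\Psi=\forall x\forall y\,\psi_0\wedge\bigwedge_{i=1}^{m}\gamma_i\wedge\bigwedge_{i=1}^{m'}\delta_i,\qquad \gamma_i=\forall x\exists y\,\psi_i^{d_i}(x,y),\quad \delta_i=\forall x\exists y\,\chi_i^{\leftrightarrow}(x,y),\quad d_i\in\{\rightarrow,\leftarrow\},$$ with $\psi_0,\psi_i,\chi_i$ quantifier-free in $x,y$ (with equality), where $\psi^{\rightarrow}=Txy\wedge\neg Tyx\wedge\psi$, $\psi^{\leftarrow}=\neg Txy\wedge Tyx\wedge\psi$, $\psi^{\leftrightarrow}=Txy\wedge Tyx\wedge\psi$. It is *satisfiable* if it has a model (with non-empty universe) in which $T$ is transitive. For a structure $\mathfrak A$ with transitive $T$, the clique $Cl^{\mathfrak A}(a)$ of $a$ is $\{a\}\cup\{b: Tab\wedge Tba\}$. The splice of a clique $B$ is the triple consisting of the isomorphism type of $\mathfrak A{\restriction}B$, the set of 1-types of elements $a$ with $Tab\wedge\neg Tba$ for all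 $b\in B$, and the set of 1-types of elements $a$ with $Tba\wedge\neg Tab$ for all $b\in B$. Let $s(\sigma,h)$ be the number of splices occurring in structures with transitive $T$ all of whose cliques have at most $h$ elements, and put $\mathbb M_\Psi(h)=(m+1)\cdot s(\sigma,h)^2\cdot h$. Let $W_i(a)=\{b\ne a:\mathfrak A\models\psi_i^{d_i}[a,b]\}$ be the set of proper $\gamma_i$-witnesses of $a$. **Theorem.** There are polynomials $p,q$ with natural coefficients such that for every such $\sigma$ and every normal-form sentence $\Psi$ with transitive witnesses over $\sigma$, with $h=2^{p(|\sigma|)}$ and $\mathbb M=\mathbb M_\Psi(h)$: * if $\Psi$ is satisfiable, it has a model with transitive $T$ in which every clique has at most $h$ elements; * $\mathbb M\le (m+1)\cdot 2^{2^{q(|\sigma|)}}$; * $\Psi$ is satisfiable if and only if there are a non-empty $\sigma$-structure $\mathfrak A$ and $S_0,S_1,S_2,S_3\subseteq A$ such that 1. $A$ is finite and $|A|\le 4\cdot\mathbb M$; 2. either $S_0=A$ and $S_1=S_2=S_3=\emptyset$, or $\{S_0,S_1,S_2,S_3\}$ is a partition of $A$ into non-empty sets with equivalent connection types, i.e. there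 are isomorphisms $f_k:\mathfrak A{\restriction}S_1\to\mathfrak A{\restriction}S_k$ ($k=1,2,3$), $f_1=\mathrm{id}$, such that (a) $tp^{\mathfrak A}[a,b]=tp^{\mathfrak A}[a,f_k(b)]$ for all $a\in S_0$, $b\in S_1$, $k=2,3$ (so $\langle S_0,S_1\rangle\approx\langle S_0,S_2\rangle\approx\langle S_0,S_3\rangle$), and (b) $tp^{\mathfrak A}[f_j(b),f_k(c)]=tp^{\mathfrak A}[b,f_2(c)]$ for all $b,c\in S_1$, $1\le j<k\le 3$ (so $\langle S_1,S_2\rangle\approx\langle S_2,S_3\rangle\approx\langle S_1,S_3\rangle$); 3. $\mathfrak A\models\psi_0[a,b]$ for all $a,b\in A$; 4. $T$ is transitive in $\mathfrak A$; 5. for $j=0,1,2$, every $a\in S_j$ and every $i\le m$: if $W_i(a)\cap S_0=\emptyset$ then $W_i(a)\cap S_{j+1}\ne\emptyset$; 6. for every $a\in A$ and every $i\le m'$ there is $b\in Cl^{\mathfrak A}(a)$ with $\mathfrak A\models\chi_i^{\leftrightarrow}[a,b]$. -/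

import Mathlib

open FirstOrder FirstOrder.Language

namespace TransWit

/-! ### Signatures, transitive relation, types -/

/-- All relation symbols are unary or binary. -/
def IsUnaryBinary (L : FirstOrder.Language.{0, 0}) : Prop :=
  ∀ n, Nonempty (L.Relations n) → n = 1 ∨ n = 2

/-- `|σ|`: the number of relation symbols of the signature. -/
noncomputable def sigSize (L : FirstOrder.Language.{0, 0}) : ℕ := Nat.card (Σ n, L.Relations n)

variable {L : FirstOrder.Language.{0, 0}}

/-- The interpretation of a binary symbol `R` as a binary relation. -/
def rel {A : Type} [L.Structure A] (R : L.Relations 2) (a b : A) : Prop :=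
  Structure.RelMap R ![a, b]

/-- `R` is interpreted as a transitive relation on `A`. -/
def TransOn (R : L.Relations 2) (A : Type) [L.Structure A] : Prop :=
  ∀ a b c : A, rel R a b → rel R b c → rel R a c

/-- `1`-types over a signature of unary and binary symbols: a `1`-type in the variable `x` is given
by the set of unary `U` with the atom `U x`, and the set of binary `R` with the atom `R x x`. -/
abbrev OneType (L : FirstOrder.Language.{0, 0}) : Type := Set (L.Relations 1) × Set (L.Relations 2)

/-- `2`-types in `x ≠ y`: the `1`-type of `x`, the `1`-type of `y`, the set of `R` with `R x y`,
the set of `R` with `R y x`. -/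
abbrev TwoType (L : FirstOrder.Language.{0, 0}) : Type :=
  OneType L × OneType L × Set (L.Relations 2) × Set (L.Relations 2)

/-- The `1`-type realized by `a`. -/
def tp1 {A : Type} [L.Structure A] (a : A) : OneType L :=
  ({U | Structure.RelMap U ![a]}, {R | rel R a a})

/-- The `2`-type realized by a pair `a, b` of distinct elements. -/
def tp2 {A : Type} [L.Structure A] (a b : A) : TwoType L :=
  (tp1 a, tp1 b, {R | rel R a b}, {R | rel R b a})

/-! ### Cliques and splices -/

/-- A set is `T`-connected if any two distinct elements of it are related by `T` both ways. -/
def Connected {A : Type} [L.Structure A] (T : L.Relations 2) (B : Set A) : Prop :=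
  ∀ a ∈ B, ∀ b ∈ B, a ≠ b → rel T a b ∧ rel T b a

/-- The clique of `a`, i.e. (for transitive `T`) the unique maximal `T`-connected set
containing `a`. -/
def clique {A : Type} [L.Structure A] (T : L.Relations 2) (a : A) : Set A :=
  {b | b = a ∨ (rel T a b ∧ rel T b a)}

theorem maximal_clique {A : Type} [L.Structure A] (T : L.Relations 2) (hT : TransOn T A) (a : A) :
    Maximal (Connected T) (clique T a) := by
  refine ⟨?_, ?_⟩
  · rintro b (rfl | ⟨h1, h2⟩) c (rfl | ⟨h3, h4⟩) hne
    · exact absurd rfl hne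
    · exact ⟨h3, h4⟩
    · exact ⟨h2, h1⟩
    · exact ⟨hT _ _ _ h2 h3, hT _ _ _ h4 h1⟩
  · intro C hC hle b hb
    by_cases h : b = a
    · exact Or.inl h
    · exact Or.inr (hC a (hle (Or.inl rfl)) b hb (Ne.symm h))

/-- `a <_A b`: `T a b` but not `T b a`. -/
def below {A : Type} [L.Structure A] (T : L.Relations 2) (a b : A) : Prop :=
  rel T a b ∧ ¬ rel T b a

/-- The substructure induced on a set, for a relational signature. -/
instance inducedStructure [L.IsRelational] {A : Type} [L.Structure A] (B : Set A) :
    L.Structure B where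
  funMap := fun f => isEmptyElim f
  RelMap := fun R x => Structure.RelMap R (fun i => (x i : A))

/-- Splices: an isomorphism type of structures together with two sets of `1`-types. -/
abbrev Splice (L : FirstOrder.Language.{0, 0}) : Type 1 :=
  Quotient (equivSetoid : Setoid (CategoryTheory.Bundled.{0} L.Structure)) ×
    Set (OneType L) × Set (OneType L)

/-- The splice of the clique of `a`: its isomorphism type, the set `In` of `1`-types realized
below the clique, and the set `Out` of `1`-types realized above the clique. -/
def splice [L.IsRelational] {A : Type} [L.Structure A] (T : L.Relations 2) (a : A) : Splice L :=
  (Quotient.mk equivSetoid (CategoryTheory.Bundled.of (c := L.Structure) (clique T a)),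
    {t | ∃ b : A, (∀ c ∈ clique T a, below T b c) ∧ tp1 b = t},
    {t | ∃ b : A, (∀ c ∈ clique T a, below T c b) ∧ tp1 b = t})

/-- All cliques of `A` have at most `h` elements. -/
def CliquesBounded (T : L.Relations 2) (h : ℕ) (A : Type) [L.Structure A] : Prop :=
  ∀ a : A, (clique T a).encard ≤ h

/-- The number of splices that are realized in structures with transitive `T` all of whose cliques
have at most `h` elements. -/
noncomputable def spliceCount [L.IsRelational] (T : L.Relations 2) (h : ℕ) : ℕ :=
  Set.ncard {t : Splice L | ∃ (A : Type) (_ : L.Structure A),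
    TransOn T A ∧ CliquesBounded T h A ∧ ∃ a : A, splice T a = t}

/-! ### Normal-form sentences with transitive witnesses -/

/-- Quantifier-free formulas in the two variables `x = &0` and `y = &1` (with equality). -/
abbrev QF2 (L : FirstOrder.Language.{0, 0}) : Type := {φ : L.BoundedFormula Empty 2 // φ.IsQF}

/-- `A ⊨ φ[a, b]`. -/
def Holds {A : Type} [L.Structure A] (φ : L.BoundedFormula Empty 2) (a b : A) : Prop :=
  φ.Realize default ![a, b]

/-- The atom `T x y`. -/
def Txy (T : L.Relations 2) : L.BoundedFormula Empty 2 := T.boundedFormula₂ (&0) (&1)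

/-- The atom `T y x`. -/
def Tyx (T : L.Relations 2) : L.BoundedFormula Empty 2 := T.boundedFormula₂ (&1) (&0)

/-- The directions allowed for witnesses outside cliques. -/
inductive Dir
  | fwd
  | bwd

/-- `ψ^→ = T x y ∧ ¬ T y x ∧ ψ` and `ψ^← = ¬ T x y ∧ T y x ∧ ψ`. -/
def guardDir (T : L.Relations 2) : Dir → L.BoundedFormula Empty 2 → L.BoundedFormula Empty 2
  | .fwd, ψ => Txy T ⊓ (∼(Tyx T) ⊓ ψ)
  | .bwd, ψ => ∼(Txy T) ⊓ (Tyx T ⊓ ψ)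

/-- `ψ^↔ = T x y ∧ T y x ∧ ψ`. -/
def guardBoth (T : L.Relations 2) (ψ : L.BoundedFormula Empty 2) : L.BoundedFormula Empty 2 :=
  Txy T ⊓ (Tyx T ⊓ ψ)

/-- Data of a normal-form sentence with transitive witnesses,
`∀ x ∀ y ψ₀ ∧ ⋀_{i < m} ∀ x ∃ y ψ_i^{d_i} ∧ ⋀_{i < m'} ∀ x ∃ y χ_i^↔`
with all of `ψ₀, ψ_i, χ_i` quantifier-free and `d_i ∈ {→, ←}`. -/
structure NormalForm (L : FirstOrder.Language.{0, 0}) where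
  ψ₀ : QF2 L
  m : ℕ
  dir : Fin m → Dir
  ψ : Fin m → QF2 L
  m' : ℕ
  χ : Fin m' → QF2 L

namespace NormalForm

/-- The matrix of the conjunct `γ_i`. -/
def γ (Ψ : NormalForm L) (T : L.Relations 2) (i : Fin Ψ.m) : L.BoundedFormula Empty 2 :=
  guardDir T (Ψ.dir i) (Ψ.ψ i).1

/-- The matrix of the conjunct `δ_i`. -/
def δ (Ψ : NormalForm L) (T : L.Relations 2) (i : Fin Ψ.m') : L.BoundedFormula Empty 2 :=
  guardBoth T (Ψ.χ i).1

/-- The first-order sentence. -/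
noncomputable def sentence (Ψ : NormalForm L) (T : L.Relations 2) : L.Sentence :=
  Ψ.ψ₀.1.all.all ⊓
    (BoundedFormula.iInf (fun i => (Ψ.γ T i).ex.all) ⊓
      BoundedFormula.iInf (fun i => (Ψ.δ T i).ex.all))

/-- `A` is a model: `T` is transitive in `A` and the sentence is true in `A`. -/
def IsModel (Ψ : NormalForm L) (T : L.Relations 2) (A : Type) [L.Structure A] : Prop :=
  TransOn T A ∧ A ⊨ Ψ.sentence T

/-- Satisfiability over (non-empty) structures in which `T` is transitive. -/
def Satisfiable (Ψ : NormalForm L) (T : L.Relations 2) : Prop :=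
  ∃ (A : Type) (_ : L.Structure A), Nonempty A ∧ Ψ.IsModel T A

/-- `W_i(a)`: the set of proper `γ_i`-witnesses for `a`. -/
def W (Ψ : NormalForm L) (T : L.Relations 2) {A : Type} [L.Structure A] (i : Fin Ψ.m) (a : A) :
    Set A :=
  {b | Holds (Ψ.γ T i) a b ∧ a ≠ b}

/-- The bound `𝕄 = (m + 1) · s² · h` on the size of segments, where `s` is the number of splices
for the clique bound `h`. -/
noncomputable def segBound [L.IsRelational] (Ψ : NormalForm L) (T : L.Relations 2) (h : ℕ) : ℕ :=
  (Ψ.m + 1) * (spliceCount T h) ^ 2 * h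

end NormalForm

/-! ### Connection types -/

/-- The connection type `⟨B', C'⟩` is transferred from `⟨B, C⟩` with respect to isomorphisms
`f : B' ≅ B` and `g : C' ≅ C` of induced substructures (all inside one structure). -/
def Transferred [L.IsRelational] {A : Type} [L.Structure A] {B' C' B C : Set A}
    (f : B' ≃[L] B) (g : C' ≃[L] C) : Prop :=
  ∀ (b : B') (c : C'), tp2 (L := L) (b : A) (c : A) = tp2 (f b : A) (g c : A)

/-- The connection types of the segments `S 0, S 1, S 2, S 3` are equivalent, through isomorphisms
chosen once for each segment: with `f : S 1 ≅ S 2`, `g : S 1 ≅ S 3`,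
`⟨S₀,S₁⟩ ≈ ⟨S₀,S₂⟩ ≈ ⟨S₀,S₃⟩` and `⟨S₁,S₂⟩ ≈ ⟨S₂,S₃⟩ ≈ ⟨S₁,S₃⟩` with respect to `f`, `g`
(and the identity of `S₀`). -/
def EquivalentConnections (L : FirstOrder.Language.{0, 0}) [L.IsRelational] {A : Type} [L.Structure A]
    (S : Fin 4 → Set A) : Prop :=
  ∃ (f : S 1 ≃[L] S 2) (g : S 1 ≃[L] S 3),
    Transferred (FirstOrder.Language.Equiv.refl L (S 0)) f ∧
    Transferred (FirstOrder.Language.Equiv.refl L (S 0)) g ∧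
    Transferred f (g.comp f.symm) ∧
    Transferred (FirstOrder.Language.Equiv.refl L (S 1)) (g.comp f.symm)

/-- `S 0, S 1, S 2, S 3` is a partition of `A` (into non-empty blocks). -/
def IsPartition {A : Type} (S : Fin 4 → Set A) : Prop :=
  (∀ k, (S k).Nonempty) ∧ (∀ j k, j ≠ k → Disjoint (S j) (S k)) ∧ ⋃ k, S k = Set.univ

end TransWit

/-!
Truth of a normal-form sentence depends only on the `2`-types that are realized, and on which of
them each element sees (`isModel_of_types`). So a new model may be assembled from copies of elements
of a given model by choosing, for each pair of copies, a pair of the given model whose `2`-type it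
takes over. Each copy *requests* that some other copies be seen exactly as its original sees its
witnesses; if no pair receives contradictory requests from its two sides, all can be met
(`exists_glued_structure_of_requests`). Both structures below are obtained in this way.

*Small cliques* (`exists_model_cliquesBounded`). All cliques are replaced at once. Kings (elements
whose `1`-type is unique in their clique) are kept, and all other elements are replaced by copies of
exponentially many elements per clique, in three groups. Copies look for witnesses among the kings
and in the cyclically next group, so that requests between copies do not collide. A king has to look
for witnesses among copies that have not selected this king as a witness themselves; where the
canonical copies have done so, which concerns exponentially many kings only, suitable further
elements of the clique are copied as well.

*Segments* (`exists_segments`). The profile of a clique consists of the `1`-types that occur in it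
and the `1`-types that occur below it. Profile `t` is dominated by profile `u` if all `1`-types of
`t` occur below `u`. This relation is transitive, contains the order of the cliques, and wherever it
holds, elements of the two cliques can be given a `2`-type that puts the first below the second. So
copies of cliques may be ordered by domination of profiles. Cliques of equivalent profiles may be
chained in any order, and incomparable profiles come from incomparable cliques. All cliques can be
multiplied in this way, except the *solitary* ones: those of a profile that does not dominate itself
and belongs to one clique only. The base consists of the solitary cliques, the cliques of their
witnesses, and one arbitrary clique. The other segments consist, for each profile that is not
solitary and each conjunct `γ i`, of one copy of a standard clique with that profile, which is
reserved for the `γ i`-witnesses demanded by the preceding segments. The reserved copies ascend or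
descend from segment to segment according to the direction of `γ i`. Since there are at most as many
profiles as splices, and at least as many splices as sizes of cliques (`le_spliceCount`), the size
is as small as claimed.

*Converse* (`isModel_of_segments`). Repeating the first segment infinitely often gives a model: any
three elements of it embed into the base and the three given segments, so that transitivity of `T`
and the universal conjunct carry over, and the witnesses of one copy are found in the next.
-/

namespace TransWit

variable {L : FirstOrder.Language.{0, 0}}

/-! ### Types and quantifier-free formulas -/

theorem tp2_fst {A B : Type} [L.Structure A] [L.Structure B] {a b : A} {x y : B}
    (h : tp2 (L := L) a b = tp2 x y) : tp1 (L := L) a = tp1 x := congrArg Prod.fst h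

theorem tp2_snd {A B : Type} [L.Structure A] [L.Structure B] {a b : A} {x y : B}
    (h : tp2 (L := L) a b = tp2 x y) : tp1 (L := L) b = tp1 y := congrArg (fun t => t.2.1) h

theorem tp2_rel {A B : Type} [L.Structure A] [L.Structure B] {a b : A} {x y : B}
    (h : tp2 (L := L) a b = tp2 x y) (R : L.Relations 2) : rel R a b ↔ rel R x y :=
  Set.ext_iff.1 (congrArg (fun t => t.2.2.1) h) R

theorem tp2_rel' {A B : Type} [L.Structure A] [L.Structure B] {a b : A} {x y : B}
    (h : tp2 (L := L) a b = tp2 x y) (R : L.Relations 2) : rel R b a ↔ rel R y x :=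
  Set.ext_iff.1 (congrArg (fun t => t.2.2.2) h) R

theorem tp2_swap {A B : Type} [L.Structure A] [L.Structure B] {a b : A} {x y : B}
    (h : tp2 (L := L) a b = tp2 x y) : tp2 (L := L) b a = tp2 y x := by
  simp only [tp2, Prod.mk.injEq] at h ⊢
  exact ⟨h.2.1, h.1, h.2.2.2, h.2.2.1⟩

theorem tp1_unary {A B : Type} [L.Structure A] [L.Structure B] {a : A} {x : B}
    (h : tp1 (L := L) a = tp1 x) (U : L.Relations 1) :
    Structure.RelMap U ![a] ↔ Structure.RelMap U ![x] :=
  Set.ext_iff.1 (congrArg Prod.fst h) U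

theorem tp1_rel {A B : Type} [L.Structure A] [L.Structure B] {a : A} {x : B}
    (h : tp1 (L := L) a = tp1 x) (R : L.Relations 2) : rel R a a ↔ rel R x x :=
  Set.ext_iff.1 (congrArg Prod.snd h) R

theorem tp2_self {A B : Type} [L.Structure A] [L.Structure B] {a : A} {x : B}
    (h : tp1 (L := L) a = tp1 x) : tp2 (L := L) a a = tp2 x x := by
  have := congrArg Prod.snd h
  simp only [tp1] at this
  simp only [tp2, h, this]

/-- An isomorphism of induced substructures preserves `2`-types. -/
theorem tp2_equiv [L.IsRelational] {A B : Type} [L.Structure A] [L.Structure B] {X : Set A}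
    {Y : Set B} (g : X ≃[L] Y) (x y : X) :
    tp2 (L := L) (g x : B) (g y : B) = tp2 (x : A) (y : A) := by
  have h1 : ∀ x : X, ∀ U : L.Relations 1,
      Structure.RelMap U ![(g x : B)] ↔ Structure.RelMap U ![(x : A)] := by
    intro x U
    have h : Structure.RelMap U (fun i => (g (![x] i) : B)) ↔
      Structure.RelMap U (fun i => (![x] i : A)) := g.map_rel U ![x]
    rwa [show (fun i => (g (![x] i) : B)) = ![(g x : B)] from funext fun i => by fin_cases i; rfl,
      show (fun i => (![x] i : A)) = ![(x : A)] from funext fun i => by fin_cases i; rfl] at h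
  have h2 : ∀ x y : X, ∀ R : L.Relations 2, rel R (g x : B) (g y : B) ↔ rel R (x : A) (y : A) := by
    intro x y R
    have h : Structure.RelMap R (fun i => (g (![x, y] i) : B)) ↔
      Structure.RelMap R (fun i => (![x, y] i : A)) := g.map_rel R ![x, y]
    rwa [show (fun i => (g (![x, y] i) : B)) = ![(g x : B), (g y : B)] from
        funext fun i => by fin_cases i <;> rfl,
      show (fun i => (![x, y] i : A)) = ![(x : A), (y : A)] from
        funext fun i => by fin_cases i <;> rfl] at h
  have h3 : ∀ x : X, tp1 (L := L) (g x : B) = tp1 (x : A) := fun x =>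
    Prod.ext (Set.ext fun U => h1 x U) (Set.ext fun R => h2 x x R)
  exact Prod.ext (h3 x) (Prod.ext (h3 y)
    (Prod.ext (Set.ext fun R => h2 x y R) (Set.ext fun R => h2 y x R)))

/-- A bijection between sets that preserves `2`-types is an isomorphism. -/
theorem exists_equiv_of_tp2 [L.IsRelational] (hL : IsUnaryBinary L) {N : Type} [L.Structure N]
    {B C : Set N} (g : B ≃ C)
    (h : ∀ a b : B, tp2 (L := L) (a : N) (b : N) = tp2 (g a : N) (g b : N)) :
    ∃ f : B ≃[L] C, ∀ x, f x = g x := by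
  refine ⟨⟨g, fun f => isEmptyElim f, ?_⟩, fun _ => rfl⟩
  intro n R x
  change Structure.RelMap R (fun i => (g (x i) : N)) ↔ Structure.RelMap R fun i => (x i : N)
  rcases hL n ⟨R⟩ with rfl | rfl
  · rw [show (fun i => (g (x i) : N)) = ![(g (x 0) : N)] from funext fun i => by fin_cases i; rfl,
      show (fun i => (x i : N)) = ![(x 0 : N)] from funext fun i => by fin_cases i; rfl]
    exact (tp1_unary (tp2_fst (h (x 0) (x 0))) R).symm
  · rw [show (fun i => (g (x i) : N)) = ![(g (x 0) : N), (g (x 1) : N)] from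
        funext fun i => by fin_cases i <;> rfl,
      show (fun i => (x i : N)) = ![(x 0 : N), (x 1 : N)] from
        funext fun i => by fin_cases i <;> rfl]
    exact (tp2_rel (h (x 0) (x 1)) R).symm

/-- A quantifier-free formula in two variables depends on the `2`-type and on equality only. -/
theorem holds_iff [L.IsRelational] (hL : IsUnaryBinary L) {A B : Type} [L.Structure A]
    [L.Structure B] {a b : A} {x y : B} (heq : a = b ↔ x = y) (h : tp2 (L := L) a b = tp2 x y)
    {φ : L.BoundedFormula Empty 2} (hφ : φ.IsQF) : Holds φ a b ↔ Holds φ x y := by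
  have hvar : ∀ t : L.Term (Empty ⊕ Fin 2),
      t = Term.var (Sum.inr 0) ∨ t = Term.var (Sum.inr 1) := by
    intro t
    cases t with
    | var v =>
      rcases v with v | v
      · exact v.elim
      · fin_cases v
        · exact Or.inl rfl
        · exact Or.inr rfl
    | func f _ => exact isEmptyElim f
  induction hφ with
  | falsum => exact Iff.rfl
  | imp h₁ h₂ ih₁ ih₂ =>
    unfold Holds at ih₁ ih₂ ⊢
    rw [BoundedFormula.realize_imp, BoundedFormula.realize_imp]
    exact imp_congr ih₁ ih₂
  | of_isAtomic hat =>
    cases hat with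
    | equal t₁ t₂ =>
      unfold Holds
      rw [BoundedFormula.realize_bdEqual, BoundedFormula.realize_bdEqual]
      rcases hvar t₁ with rfl | rfl <;> rcases hvar t₂ with rfl | rfl <;> simp [heq, eq_comm]
    | @rel n R ts =>
      unfold Holds
      rw [BoundedFormula.realize_rel, BoundedFormula.realize_rel]
      rcases hL n ⟨R⟩ with rfl | rfl
      · have e : ∀ (C : Type) [L.Structure C] (v : Empty ⊕ Fin 2 → C),
            (fun i => (ts i).realize v) = ![(ts 0).realize v] := by
          intro C _ v
          funext i
          fin_cases i
          rfl
        rw [e A, e B]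
        rcases hvar (ts 0) with h0 | h0 <;> rw [h0]
        · exact tp1_unary (tp2_fst h) R
        · exact tp1_unary (tp2_snd h) R
      · have e : ∀ (C : Type) [L.Structure C] (v : Empty ⊕ Fin 2 → C),
            (fun i => (ts i).realize v) = ![(ts 0).realize v, (ts 1).realize v] := by
          intro C _ v
          funext i
          fin_cases i <;> rfl
        rw [e A, e B]
        rcases hvar (ts 0) with h0 | h0 <;> rcases hvar (ts 1) with h1 | h1 <;> rw [h0, h1]
        · exact tp1_rel (tp2_fst h) R
        · exact tp2_rel h R
        · exact tp2_rel' h R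
        · exact tp1_rel (tp2_snd h) R

theorem holds_Txy {A : Type} [L.Structure A] (T : L.Relations 2) (a b : A) :
    Holds (Txy T) a b ↔ rel T a b := by
  unfold Holds Txy rel
  rw [BoundedFormula.realize_rel₂]
  rfl

theorem holds_Tyx {A : Type} [L.Structure A] (T : L.Relations 2) (a b : A) :
    Holds (Tyx T) a b ↔ rel T b a := by
  unfold Holds Tyx rel
  rw [BoundedFormula.realize_rel₂]
  rfl

theorem isQF_Txy (T : L.Relations 2) : (Txy T).IsQF :=
  (BoundedFormula.IsAtomic.rel T _).isQF

theorem isQF_Tyx (T : L.Relations 2) : (Tyx T).IsQF :=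
  (BoundedFormula.IsAtomic.rel T _).isQF

namespace NormalForm

theorem isQF_γ (Ψ : NormalForm L) (T : L.Relations 2) (i : Fin Ψ.m) : (Ψ.γ T i).IsQF := by
  unfold γ
  cases Ψ.dir i
  · exact (isQF_Txy T).inf ((isQF_Tyx T).not.inf (Ψ.ψ i).2)
  · exact (isQF_Txy T).not.inf ((isQF_Tyx T).inf (Ψ.ψ i).2)

theorem isQF_δ (Ψ : NormalForm L) (T : L.Relations 2) (i : Fin Ψ.m') : (Ψ.δ T i).IsQF :=
  (isQF_Txy T).inf ((isQF_Tyx T).inf (Ψ.χ i).2)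

theorem below_of_holds_γ {Ψ : NormalForm L} {T : L.Relations 2} {i : Fin Ψ.m} {A : Type}
    [L.Structure A] {a b : A} (h : Holds (Ψ.γ T i) a b) :
    (Ψ.dir i = .fwd ∧ below T a b) ∨ (Ψ.dir i = .bwd ∧ below T b a) := by
  unfold γ at h
  cases hd : Ψ.dir i <;> rw [hd] at h
  · have h1 := BoundedFormula.realize_inf.1 h
    have h2 := BoundedFormula.realize_inf.1 h1.2
    exact Or.inl ⟨rfl, (holds_Txy T a b).1 h1.1, fun hc =>
      BoundedFormula.realize_not.1 h2.1 ((holds_Tyx T a b).2 hc)⟩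
  · have h1 := BoundedFormula.realize_inf.1 h
    have h2 := BoundedFormula.realize_inf.1 h1.2
    exact Or.inr ⟨rfl, (holds_Tyx T a b).1 h2.1, fun hc =>
      BoundedFormula.realize_not.1 h1.1 ((holds_Txy T a b).2 hc)⟩

theorem ne_of_holds_γ {Ψ : NormalForm L} {T : L.Relations 2} {i : Fin Ψ.m} {A : Type}
    [L.Structure A] {a b : A} (h : Holds (Ψ.γ T i) a b) : a ≠ b := by
  rintro rfl
  rcases below_of_holds_γ h with h | h <;> exact h.2.2 h.2.1

theorem mem_clique_of_holds_δ {Ψ : NormalForm L} {T : L.Relations 2} {i : Fin Ψ.m'} {A : Type}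
    [L.Structure A] {a b : A} (h : Holds (Ψ.δ T i) a b) : b ∈ clique T a := by
  have h1 := BoundedFormula.realize_inf.1 h
  have h2 := BoundedFormula.realize_inf.1 h1.2
  exact Or.inr ⟨(holds_Txy T a b).1 h1.1, (holds_Tyx T a b).1 h2.1⟩

theorem isModel_iff (Ψ : NormalForm L) (T : L.Relations 2) (A : Type) [L.Structure A] :
    Ψ.IsModel T A ↔ TransOn T A ∧ (∀ a b : A, Holds Ψ.ψ₀.1 a b) ∧
      (∀ i, ∀ a : A, ∃ b, Holds (Ψ.γ T i) a b) ∧ (∀ i, ∀ a : A, ∃ b, Holds (Ψ.δ T i) a b) := by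
  have e : ∀ a b : A, Fin.snoc (Fin.snoc (default : Fin 0 → A) a) b = ![a, b] := by
    intro a b
    funext i
    fin_cases i <;> rfl
  unfold IsModel sentence Sentence.Realize Formula.Realize
  rw [BoundedFormula.realize_inf, BoundedFormula.realize_inf]
  simp only [BoundedFormula.realize_iInf, BoundedFormula.realize_all, BoundedFormula.realize_ex, e]
  rfl

end NormalForm

/-- Truth of a normal-form sentence passes from `A` to `N` if the `2`-types of distinct elements of
`N` occur in `A`, and every element of `N` sees all `2`-types that some element of `A` with the
same `1`-type sees. -/
theorem isModel_of_types [L.IsRelational] (hL : IsUnaryBinary L) {T : L.Relations 2}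
    {Ψ : NormalForm L} {A N : Type} [L.Structure A] [L.Structure N] (hA : Ψ.IsModel T A)
    (hT : TransOn T N) (hpair : ∀ e f : N, e ≠ f → ∃ x y : A, x ≠ y ∧ tp2 (L := L) e f = tp2 x y)
    (hwit : ∀ e : N, ∃ x : A, tp1 (L := L) e = tp1 x ∧
      ∀ y, y ≠ x → ∃ f, f ≠ e ∧ tp2 (L := L) e f = tp2 x y) : Ψ.IsModel T N := by
  rw [NormalForm.isModel_iff] at hA ⊢
  obtain ⟨-, h0, hγ, hδ⟩ := hA
  have key : ∀ {φ : L.BoundedFormula Empty 2}, φ.IsQF → (∀ x : A, ∃ y, Holds φ x y) →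
      ∀ e : N, ∃ f, Holds φ e f := by
    intro φ hφ h e
    obtain ⟨x, hx, hw⟩ := hwit e
    obtain ⟨y, hy⟩ := h x
    by_cases hyx : y = x
    · subst hyx
      exact ⟨e, (holds_iff hL (by simp) (tp2_self hx) hφ).2 hy⟩
    · obtain ⟨f, hf, ht⟩ := hw y hyx
      exact ⟨f, (holds_iff hL (iff_of_false hf.symm (Ne.symm hyx)) ht hφ).2 hy⟩
  refine ⟨hT, ?_, fun i => key (Ψ.isQF_γ T i) (hγ i), fun i => key (Ψ.isQF_δ T i) (hδ i)⟩
  intro e f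
  by_cases hef : e = f
  · subst hef
    obtain ⟨x, hx, -⟩ := hwit e
    exact (holds_iff hL (by simp) (tp2_self hx) Ψ.ψ₀.2).2 (h0 x x)
  · obtain ⟨x, y, hxy, ht⟩ := hpair e f hef
    exact (holds_iff hL (iff_of_false hef hxy) ht Ψ.ψ₀.2).2 (h0 x y)

/-! ### Structures glued from types of another structure -/

/-- The structure on `N` in which the atoms of a pair are copied from a pair of elements of `A`. -/
theorem exists_structure_of_pairs [L.IsRelational] {A N : Type} [L.Structure A] (o : N → A)
    (pr : N → N → A × A) (hdiag : ∀ e, pr e e = (o e, o e)) (hswap : ∀ e f, pr f e = (pr e f).swap)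
    (htp : ∀ e f, tp1 (L := L) (pr e f).1 = tp1 (o e)) :
    ∃ _ : L.Structure N, (∀ e : N, tp1 (L := L) e = tp1 (o e)) ∧
      ∀ e f : N, tp2 (L := L) e f = tp2 (pr e f).1 (pr e f).2 := by
  let S : L.Structure N :=
    { funMap := fun f => isEmptyElim f
      RelMap := fun {n} R v => match n, R, v with
        | 1, R, v => Structure.RelMap R ![o (v 0)]
        | 2, R, v => rel R (pr (v 0) (v 1)).1 (pr (v 0) (v 1)).2
        | _, _, _ => False }
  have hrel : ∀ (R : L.Relations 2) (e f : N), rel R e f ↔ rel R (pr e f).1 (pr e f).2 :=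
    fun R e f => Iff.rfl
  have h1 : ∀ e : N, tp1 (L := L) e = tp1 (o e) := by
    intro e
    refine Prod.ext (Set.ext fun U => Iff.rfl) (Set.ext fun R => ?_)
    change rel R e e ↔ rel R (o e) (o e)
    rw [hrel, hdiag]
  refine ⟨S, h1, fun e f => ?_⟩
  refine Prod.ext ?_ (Prod.ext ?_ (Prod.ext (Set.ext fun R => hrel R e f) (Set.ext fun R => ?_)))
  · exact (h1 e).trans (htp e f).symm
  · refine (h1 f).trans ?_
    have := htp f e
    rw [hswap e f] at this
    exact this.symm
  · change rel R f e ↔ rel R (pr e f).2 (pr e f).1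
    rw [hrel, hswap e f]
    rfl

/-- Gluing along a specification: if `Sp e f x y` says that the pair `e, f` of distinct elements may
copy the pair `x, y` of `A`, then there is a structure in which all pairs do so. The relation `lt`
serves to choose for `e, f` and for `f, e` consistently; the `2`-type of `e, f` depends on the
specification and on `lt` only. -/
theorem exists_glued_structure [L.IsRelational] {A N : Type} [L.Structure A] (o : N → A)
    (Sp : N → N → A → A → Prop) (lt : N → N → Prop)
    (hlt : ∀ e f, e ≠ f → (lt e f ↔ ¬ lt f e))
    (hsymm : ∀ e f x y, Sp e f x y → Sp f e y x)
    (hne : ∀ e f, e ≠ f → ∃ x y, Sp e f x y)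
    (htp : ∀ e f x y, Sp e f x y → tp1 (L := L) x = tp1 (o e)) :
    ∃ _ : L.Structure N, (∀ e : N, tp1 (L := L) e = tp1 (o e)) ∧
      (∀ e f : N, e ≠ f → ∃ x y, Sp e f x y ∧ tp2 (L := L) e f = tp2 x y) ∧
      (∀ e f e' f' : N, e ≠ f → e' ≠ f' → Sp e f = Sp e' f' → (lt e f ↔ lt e' f') →
        tp2 (L := L) e f = tp2 e' f') := by
  classical
  have hne' : ∀ e f, e ≠ f → ∃ p : A × A, Sp e f p.1 p.2 := fun e f h => by
    obtain ⟨x, y, hxy⟩ := hne e f h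
    exact ⟨(x, y), hxy⟩
  let ch : N → N → A × A := fun e f =>
    @Classical.epsilon _ ⟨(o e, o e)⟩ (fun p : A × A => Sp e f p.1 p.2)
  have hch : ∀ e f, e ≠ f → Sp e f (ch e f).1 (ch e f).2 := fun e f h =>
    Classical.epsilon_spec (hne' e f h)
  let pr : N → N → A × A := fun e f =>
    if e = f then (o e, o e) else if lt e f then ch e f else (ch f e).swap
  have hspec : ∀ e f, e ≠ f → Sp e f (pr e f).1 (pr e f).2 := by
    intro e f h
    simp only [pr, if_neg h]
    split_ifs with hl
    · exact hch e f h
    · exact hsymm _ _ _ _ (hch f e h.symm)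
  have hdiag : ∀ e, pr e e = (o e, o e) := fun e => by simp [pr]
  have hswap : ∀ e f, pr f e = (pr e f).swap := by
    intro e f
    by_cases h : e = f
    · subst h
      simp [hdiag]
    · simp only [pr, if_neg h, if_neg (Ne.symm h)]
      by_cases hl : lt e f
      · rw [if_pos hl, if_neg ((hlt e f h).1 hl)]
      · rw [if_neg hl, if_pos (by_contra fun hc => hl ((hlt e f h).2 hc)), Prod.swap_swap]
  have htp' : ∀ e f, tp1 (L := L) (pr e f).1 = tp1 (o e) := by
    intro e f
    by_cases h : e = f
    · subst h
      rw [hdiag]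
    · exact htp _ _ _ _ (hspec e f h)
  obtain ⟨S, h1, h2⟩ := exists_structure_of_pairs o pr hdiag hswap htp'
  refine ⟨S, h1, fun e f h => ⟨_, _, hspec e f h, h2 e f⟩, ?_⟩
  intro e f e' f' h h' hSp hl
  have hSp' : Sp f e = Sp f' e' := by
    funext x y
    exact propext ⟨fun hs => hsymm _ _ _ _ (hSp ▸ hsymm _ _ _ _ hs),
      fun hs => hsymm _ _ _ _ (hSp ▸ hsymm _ _ _ _ hs)⟩
  have hc : ch e f = ch e' f' := by
    simp only [ch, hSp]
  have hc' : ch f e = ch f' e' := by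
    simp only [ch, hSp']
  have : pr e f = pr e' f' := by
    simp only [pr, if_neg h, if_neg h', hl, hc, hc']
  rw [h2, h2, this]

/-- Gluing along requests. `Good e f x y` lists the pairs that `e, f` may copy, and `Rq e f z` is
the request of `e` to see `f` as the original `o e` of `e` sees `z`. If a pair is requested from
both sides only when both sides ask for the pair of originals, all requests can be met at once. -/
theorem exists_glued_structure_of_requests [L.IsRelational] {A N : Type} [L.Structure A] (o : N → A)
    (Good : N → N → A → A → Prop) (Rq : N → N → A → Prop) (lt : N → N → Prop)
    (hlt : ∀ e f, e ≠ f → (lt e f ↔ ¬ lt f e))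
    (hsymm : ∀ e f x y, Good e f x y → Good f e y x)
    (hne : ∀ e f, e ≠ f → ∃ x y, Good e f x y)
    (htp : ∀ e f x y, Good e f x y → tp1 (L := L) x = tp1 (o e))
    (hRq : ∀ e f z, e ≠ f → Rq e f z → Good e f (o e) z)
    (huniq : ∀ e f z z', e ≠ f → Rq e f z → Rq e f z' → z = z')
    (hboth : ∀ e f z z', e ≠ f → Rq e f z → Rq f e z' → z = o f) :
    ∃ _ : L.Structure N, (∀ e : N, tp1 (L := L) e = tp1 (o e)) ∧
      (∀ e f : N, e ≠ f → ∃ x y, Good e f x y ∧ tp2 (L := L) e f = tp2 x y) ∧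
      (∀ e f z, e ≠ f → Rq e f z → tp2 (L := L) e f = tp2 (o e) z) ∧
      (∀ e f e' f' : N, e ≠ f → e' ≠ f' → o e = o e' → o f = o f' →
        (∀ x y, Good e f x y ↔ Good e' f' x y) → (∀ z, Rq e f z ↔ Rq e' f' z) →
        (∀ z, Rq f e z ↔ Rq f' e' z) → (lt e f ↔ lt e' f') →
        tp2 (L := L) e f = tp2 e' f') := by
  obtain ⟨S, h1, h2, h3⟩ := exists_glued_structure (L := L) o
    (fun e f x y => Good e f x y ∧ (∀ z, Rq e f z → x = o e ∧ y = z) ∧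
      (∀ z, Rq f e z → y = o f ∧ x = z)) lt hlt
    (fun e f x y h => ⟨hsymm _ _ _ _ h.1, h.2.2, h.2.1⟩)
    (fun e f hef => by
      by_cases h : ∃ z, Rq e f z
      · obtain ⟨z, hz⟩ := h
        refine ⟨o e, z, hRq e f z hef hz, fun z' hz' => ⟨rfl, huniq e f z z' hef hz hz'⟩,
          fun z' hz' => ⟨hboth e f z z' hef hz hz', (hboth f e z' z hef.symm hz' hz).symm⟩⟩
      · by_cases h' : ∃ z, Rq f e z
        · obtain ⟨z, hz⟩ := h'
          exact ⟨z, o f, hsymm _ _ _ _ (hRq f e z hef.symm hz), fun z' hz' => absurd ⟨z', hz'⟩ h,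
            fun z' hz' => ⟨rfl, huniq f e z z' hef.symm hz hz'⟩⟩
        · obtain ⟨x, y, hxy⟩ := hne e f hef
          exact ⟨x, y, hxy, fun z' hz' => absurd ⟨z', hz'⟩ h, fun z' hz' => absurd ⟨z', hz'⟩ h'⟩)
    (fun e f x y h => htp e f x y h.1)
  refine ⟨S, h1, fun e f hef => ?_, fun e f z hef hz => ?_, ?_⟩
  · obtain ⟨x, y, h, ht⟩ := h2 e f hef
    exact ⟨x, y, h.1, ht⟩
  · obtain ⟨x, y, h, ht⟩ := h2 e f hef
    obtain ⟨rfl, rfl⟩ := h.2.1 z hz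
    exact ht
  · intro e f e' f' hef hef' ho ho' hG hR hR' hl
    refine h3 e f e' f' hef hef' ?_ hl
    funext x y
    simp only [hG, hR, hR', ho, ho']

/-! ### Cliques -/

section Clique

variable {A : Type} [L.Structure A] {T : L.Relations 2}

theorem mem_clique_self (a : A) : a ∈ clique T a := Or.inl rfl

theorem mem_clique_symm {a b : A} (h : b ∈ clique T a) : a ∈ clique T b := by
  rcases h with rfl | ⟨h1, h2⟩
  · exact mem_clique_self _
  · exact Or.inr ⟨h2, h1⟩

theorem mem_clique_trans (hT : TransOn T A) {a b c : A} (h : b ∈ clique T a) (h' : c ∈ clique T b) :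
    c ∈ clique T a := by
  rcases h with rfl | ⟨h1, h2⟩
  · exact h'
  · rcases h' with rfl | ⟨h3, h4⟩
    · exact Or.inr ⟨h1, h2⟩
    · exact Or.inr ⟨hT _ _ _ h1 h3, hT _ _ _ h4 h2⟩

theorem clique_eq (hT : TransOn T A) {a b : A} (h : b ∈ clique T a) : clique T b = clique T a :=
  Set.ext fun _ => ⟨fun hc => mem_clique_trans hT h hc,
    fun hc => mem_clique_trans hT (mem_clique_symm h) hc⟩

/-- Between two cliques `T` is constant. -/
theorem rel_of_mem_clique (hT : TransOn T A) {x x' y y' : A} (hx : x' ∈ clique T x)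
    (hy : y' ∈ clique T y) (h : rel T x y) : rel T x' y' := by
  have h1 : rel T x y' := by
    rcases hy with rfl | ⟨hy, -⟩
    · exact h
    · exact hT _ _ _ h hy
  rcases hx with rfl | ⟨-, hx⟩
  · exact h1
  · exact hT _ _ _ hx h1

theorem below_of_mem_clique (hT : TransOn T A) {x x' y y' : A} (hx : x' ∈ clique T x)
    (hy : y' ∈ clique T y) (h : below T x y) : below T x' y' := by
  exact ⟨rel_of_mem_clique hT hx hy h.1, fun hc => h.2
    (rel_of_mem_clique hT (mem_clique_symm hy) (mem_clique_symm hx) hc)⟩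

end Clique

/-! ### Finiteness of the sets of types -/

section Card

variable [Finite (Σ n, L.Relations n)]

instance finite_relations (k : ℕ) : Finite (L.Relations k) :=
  Finite.of_injective (fun R : L.Relations k => (⟨k, R⟩ : Σ n, L.Relations n))
    fun _ _ h => eq_of_heq (Sigma.mk.inj h).2

theorem card_relations_add_le (L : FirstOrder.Language.{0, 0}) [Finite (Σ n, L.Relations n)] :
    Nat.card (L.Relations 1) + Nat.card (L.Relations 2) ≤ sigSize L := by
  rw [← Nat.card_sum]
  refine Nat.card_le_card_of_injective
    (Sum.elim (fun R => (⟨1, R⟩ : Σ n, L.Relations n)) (fun R => ⟨2, R⟩)) ?_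
  rintro (R | R) (S | S) h
  · exact congrArg Sum.inl (eq_of_heq (Sigma.mk.inj h).2)
  · exact absurd (Sigma.mk.inj h).1 (by norm_num)
  · exact absurd (Sigma.mk.inj h).1 (by norm_num)
  · exact congrArg Sum.inr (eq_of_heq (Sigma.mk.inj h).2)

theorem natCard_set (α : Type) [Finite α] : Nat.card (Set α) = 2 ^ Nat.card α := by
  have := Fintype.ofFinite α
  rw [Nat.card_eq_fintype_card, Nat.card_eq_fintype_card, Fintype.card_set]

theorem card_oneType_le (L : FirstOrder.Language.{0, 0}) [Finite (Σ n, L.Relations n)] :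
    Nat.card (OneType L) ≤ 2 ^ sigSize L := by
  rw [Nat.card_prod, natCard_set, natCard_set, ← pow_add]
  exact Nat.pow_le_pow_right (by norm_num) (card_relations_add_le L)

theorem card_twoType_le (L : FirstOrder.Language.{0, 0}) [Finite (Σ n, L.Relations n)] :
    Nat.card (TwoType L) ≤ 2 ^ (4 * sigSize L) := by
  have h1 := card_oneType_le L
  have h2 : Nat.card (Set (L.Relations 2)) ≤ 2 ^ sigSize L := by
    rw [natCard_set]
    exact Nat.pow_le_pow_right (by norm_num) (by have := card_relations_add_le L; omega)
  rw [Nat.card_prod (OneType L), Nat.card_prod (OneType L), Nat.card_prod (Set (L.Relations 2))]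
  calc _ ≤ 2 ^ sigSize L * (2 ^ sigSize L * (2 ^ sigSize L * 2 ^ sigSize L)) := by gcongr
    _ = 2 ^ (4 * sigSize L) := by rw [← pow_add, ← pow_add, ← pow_add]; congr 1; ring

end Card

/-! ### Small cliques -/

section SmallClique

variable {A : Type} [L.Structure A] (T : L.Relations 2)

/-- A king: the only element of its clique with its `1`-type. -/
def King (a : A) : Prop := ∀ b ∈ clique T a, tp1 (L := L) b = tp1 a → b = a

/-- A canonical element with the same clique and the same `1`-type as `a`. -/
noncomputable def kin (a : A) : A :=
  @Classical.epsilon A ⟨a⟩ fun b => b ∈ clique T a ∧ tp1 (L := L) b = tp1 a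

/-- `y` shows, in the clique and with the `1`-type of `c`, that `b` sees the `2`-type `τ`. -/
def IsKinWitness (b c : A) (τ : TwoType L) (y : A) : Prop :=
  y ∈ clique T c ∧ tp1 (L := L) y = tp1 c ∧ y ≠ b ∧ tp2 b y = τ

/-- A choice of an element as in `IsKinWitness`. -/
noncomputable def kinWitness (b c : A) (τ : TwoType L) : A :=
  @Classical.epsilon A ⟨b⟩ (IsKinWitness T b c τ)

/-- For each `2`-type `τ` that `x` sees, a choice of an element with which `x` realizes `τ`. -/
noncomputable def witness (x : A) (τ : TwoType L) : A :=
  @Classical.epsilon A ⟨x⟩ fun y => y ≠ x ∧ tp2 x y = τ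

/-- The elements chosen as witnesses for `x`. -/
def Selected (L : FirstOrder.Language.{0, 0}) {A : Type} [L.Structure A] (x y : A) : Prop :=
  ∃ τ : TwoType L, y = witness x τ

/-- The elements other than kings of which the small cliques have copies. Besides one element for
each `1`-type of each clique, they comprise witnesses for those elements that the former have
selected as their own witnesses. -/
def pattern : Set A :=
  {c | ¬ King T c ∧ (c = kin T c ∨
    ∃ τ τ' : TwoType L, c = kinWitness T (witness (kin T c) τ) (kin T c) τ')}

/-- The universe of the structure with small cliques: all kings, and for each element of the
pattern three groups of copies, with one copy in each group for each `2`-type. -/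
abbrev SmallUniverse (A : Type) [L.Structure A] : Type :=
  {a : A // King T a} ⊕ ({c : A // c ∈ pattern T} × Fin 3 × TwoType L)

/-- The element of which an element of the new universe is a copy. -/
def orig : SmallUniverse T A → A := Sum.elim (fun a => a.1) (fun p => p.1.1)

variable {T}

theorem kin_spec (a : A) : kin T a ∈ clique T a ∧ tp1 (L := L) (kin T a) = tp1 a :=
  @Classical.epsilon_spec A (fun b => b ∈ clique T a ∧ tp1 (L := L) b = tp1 a)
    ⟨a, mem_clique_self a, rfl⟩

theorem kin_congr (hT : TransOn T A) {a b : A} (h : b ∈ clique T a)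
    (h' : tp1 (L := L) b = tp1 a) : kin T b = kin T a := by
  unfold kin
  rw [clique_eq hT h, h']

theorem kin_kin (hT : TransOn T A) (a : A) : kin T (kin T a) = kin T a :=
  kin_congr hT (kin_spec a).1 (kin_spec a).2

theorem King.kin_eq {a : A} (h : King T a) : kin T a = a := h _ (kin_spec a).1 (kin_spec a).2

theorem King.of_mem {a b : A} (ha : King T a) (h : b ∈ clique T a)
    (h' : tp1 (L := L) b = tp1 a) : b = a ∧ King T b := by
  have := ha b h h'
  subst this
  exact ⟨rfl, ha⟩

theorem kinWitness_spec {b c : A} {τ : TwoType L} (h : ∃ y, IsKinWitness T b c τ y) :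
    IsKinWitness T b c τ (kinWitness T b c τ) := Classical.epsilon_spec h

theorem witness_spec {x y : A} (h : y ≠ x) :
    witness x (tp2 (L := L) x y) ≠ x ∧ tp2 (L := L) x (witness x (tp2 (L := L) x y)) = tp2 x y :=
  @Classical.epsilon_spec A (fun z => z ≠ x ∧ tp2 (L := L) x z = tp2 x y) ⟨y, h, rfl⟩

variable (T)

/-- Elements `e, f` of the new universe may copy any two distinct elements that lie in the same
cliques and have the same `1`-types as their originals. -/
def SmallGood (e f : SmallUniverse T A) (x y : A) : Prop :=
  x ∈ clique T (orig T e) ∧ tp1 (L := L) x = tp1 (orig T e) ∧ y ∈ clique T (orig T f) ∧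
    tp1 (L := L) y = tp1 (orig T f) ∧ x ≠ y

/-- The requests: kings keep their `2`-types with kings. Copies request their selected witnesses
among the kings, and the remaining `2`-types from the next group of copies, cyclically. A king
requests its `2`-types from copies of the canonical elements that have not selected it; where these
have selected it, it keeps its actual `2`-types with the further elements of the pattern. -/
def SmallRequest : SmallUniverse T A → SmallUniverse T A → A → Prop
  | .inl _, .inl y, z => z = y.1
  | .inl x, .inr (c, _, τ), z => (Selected L (kin T c.1) x.1 ∧ z = c.1) ∨
      (¬ Selected L (kin T c.1) x.1 ∧ c.1 = kin T c.1 ∧ (∃ y, IsKinWitness T x.1 c.1 τ y) ∧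
        z = kinWitness T x.1 c.1 τ)
  | .inr (c, _, _), .inl x, z => z = x.1 ∧ Selected L c.1 x.1
  | .inr (b, g, _), .inr (c, g', τ), z => g' = g + 1 ∧ c.1 = kin T c.1 ∧
      (∃ y, IsKinWitness T b.1 c.1 τ y) ∧ z = kinWitness T b.1 c.1 τ

variable {T}

theorem King.ne_of_not_king {x c : A} (hx : King T x) (hc : ¬ King T c) : x ≠ c := by
  rintro rfl
  exact hc hx

theorem exists_smallGood {e f : SmallUniverse T A} (hef : e ≠ f) :
    ∃ x y, SmallGood T e f x y := by
  by_cases ho : orig T e = orig T f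
  · have hk : ¬ King T (orig T e) := by
      rcases e with x | ⟨c, g, k⟩ <;> rcases f with y | ⟨d, g', k'⟩
      · exact absurd (congrArg Sum.inl (Subtype.ext ho)) hef
      · exact absurd ho (x.2.ne_of_not_king d.2.1)
      · exact absurd ho.symm (y.2.ne_of_not_king c.2.1)
      · exact c.2.1
    unfold King at hk
    push Not at hk
    obtain ⟨b, hb, hb', hne⟩ := hk
    exact ⟨_, b, mem_clique_self _, rfl, ho ▸ hb, ho ▸ hb', hne.symm⟩
  · exact ⟨_, _, mem_clique_self _, rfl, mem_clique_self _, rfl, ho⟩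

theorem SmallRequest.good {e f : SmallUniverse T A} {z : A} (hef : e ≠ f)
    (h : SmallRequest T e f z) : SmallGood T e f (orig T e) z := by
  have hch : ∀ {b c : A} {τ : TwoType L}, (∃ y, IsKinWitness T b c τ y) →
      kinWitness T b c τ ∈ clique T c ∧ tp1 (L := L) (kinWitness T b c τ) = tp1 c ∧
        b ≠ kinWitness T b c τ := fun h =>
    ⟨(kinWitness_spec h).1, (kinWitness_spec h).2.1, (kinWitness_spec h).2.2.1.symm⟩
  rcases e with x | ⟨c, g, k⟩ <;> rcases f with y | ⟨d, g', k'⟩ <;> simp only [SmallRequest] at h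
  · subst h
    exact ⟨mem_clique_self _, rfl, mem_clique_self _, rfl,
      fun hc => hef (congrArg Sum.inl (Subtype.ext hc))⟩
  · rcases h with ⟨-, rfl⟩ | ⟨-, -, hv, rfl⟩
    · exact ⟨mem_clique_self _, rfl, mem_clique_self _, rfl, x.2.ne_of_not_king d.2.1⟩
    · exact ⟨mem_clique_self _, rfl, hch hv⟩
  · obtain ⟨rfl, -⟩ := h
    exact ⟨mem_clique_self _, rfl, mem_clique_self _, rfl, (y.2.ne_of_not_king c.2.1).symm⟩
  · obtain ⟨-, -, hv, rfl⟩ := h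
    exact ⟨mem_clique_self _, rfl, hch hv⟩

theorem SmallRequest.unique {e f : SmallUniverse T A} {z z' : A}
    (h : SmallRequest T e f z) (h' : SmallRequest T e f z') : z = z' := by
  rcases e with x | ⟨c, g, k⟩ <;> rcases f with y | ⟨d, g', k'⟩ <;>
    simp only [SmallRequest] at h h'
  · rw [h, h']
  · rcases h with ⟨h1, rfl⟩ | ⟨h1, -, -, rfl⟩ <;> rcases h' with ⟨h2, rfl⟩ | ⟨h2, -, -, rfl⟩
    · rfl
    · exact absurd h1 h2
    · exact absurd h2 h1
    · rfl
  · rw [h.1, h'.1]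
  · rw [h.2.2.2, h'.2.2.2]

theorem SmallRequest.eq_orig {e f : SmallUniverse T A} {z z' : A}
    (h : SmallRequest T e f z) (h' : SmallRequest T f e z') : z = orig T f := by
  rcases e with x | ⟨c, g, k⟩ <;> rcases f with y | ⟨d, g', k'⟩ <;>
    simp only [SmallRequest] at h h'
  · exact h
  · rcases h with ⟨-, rfl⟩ | ⟨h1, h2, -, -⟩
    · rfl
    · exact absurd (h2 ▸ h'.2) h1
  · exact h.1
  -- With three groups, no two groups request from each other.
  · have : ∀ g g' : Fin 3, g' = g + 1 → g ≠ g' + 1 := by decide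
    exact absurd h'.1 (this _ _ h.1)

/-- Every `2`-type seen by the original of `e` is requested by `e`. -/
theorem exists_smallRequest (hT : TransOn T A) (e : SmallUniverse T A) {y : A}
    (hy : y ≠ orig T e) :
    ∃ f z, f ≠ e ∧ SmallRequest T e f z ∧ tp2 (L := L) (orig T e) z = tp2 (orig T e) y := by
  have hkin : ∀ {y : A}, ¬ King T y → ¬ King T (kin T y) := fun {y} hy hc =>
    hy (hc.of_mem (mem_clique_symm (kin_spec y).1) (kin_spec y).2.symm).2
  rcases e with x | ⟨b, g, k⟩
  · by_cases hk : King T y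
    · exact ⟨Sum.inl ⟨y, hk⟩, y, fun h => hy (congrArg Subtype.val (Sum.inl.inj h)), rfl, rfl⟩
    · have hw : IsKinWitness T x.1 (kin T y) (tp2 x.1 y) y :=
        ⟨mem_clique_symm (kin_spec y).1, (kin_spec y).2.symm, hy, rfl⟩
      by_cases hs : Selected L (kin T y) x.1
      -- The canonical element keeps its own `2`-type with the king `x`, so that `x` turns to the
      -- element that the pattern contains for this purpose.
      · obtain ⟨τ, hτ⟩ := hs
        have hw' := kinWitness_spec ⟨y, hw⟩
        set c := kinWitness T x.1 (kin T y) (tp2 x.1 y) with hc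
        have hkc : kin T c = kin T y := by rw [kin_congr hT hw'.1 hw'.2.1, kin_kin hT]
        have hcP : c ∈ pattern T := by
          refine ⟨fun hK => hkin hk ?_, Or.inr ⟨τ, tp2 x.1 y, ?_⟩⟩
          · rw [← hkc, hK.kin_eq]
            exact hK
          · rw [hkc, ← hτ]
        refine ⟨Sum.inr (⟨c, hcP⟩, 0, tp2 x.1 y), c, by simp, Or.inl ⟨?_, rfl⟩,
          hw'.2.2.2⟩
        rw [hkc]
        exact ⟨τ, hτ⟩
      · refine ⟨Sum.inr (⟨kin T y, hkin hk, Or.inl (kin_kin hT y).symm⟩, 0, tp2 x.1 y), _, by simp,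
          Or.inr ⟨?_, (kin_kin hT y).symm, ⟨y, hw⟩, rfl⟩, (kinWitness_spec ⟨y, hw⟩).2.2.2⟩
        rw [kin_kin hT]
        exact hs
  · have hs := witness_spec (L := L) hy
    set y' := witness b.1 (tp2 (L := L) b.1 y) with hy'
    by_cases hk : King T y'
    · exact ⟨Sum.inl ⟨y', hk⟩, y', by simp, ⟨rfl, _, hy'⟩, hs.2⟩
    · have hw : IsKinWitness T b.1 (kin T y') (tp2 b.1 y) y' :=
        ⟨mem_clique_symm (kin_spec y').1, (kin_spec y').2.symm, hs.1, hs.2⟩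
      refine ⟨Sum.inr (⟨kin T y', hkin hk, Or.inl (kin_kin hT y').symm⟩, g + 1, tp2 b.1 y), _, ?_,
        ⟨rfl, (kin_kin hT y').symm, ⟨y', hw⟩, rfl⟩, (kinWitness_spec ⟨y', hw⟩).2.2.2⟩
      have : ∀ g : Fin 3, g + 1 ≠ g := by decide
      intro h
      simp only [Sum.inr.injEq, Prod.mk.injEq] at h
      exact this g h.2.1

/-- The type that counts the copies in one clique: kings by their `1`-types, other elements by the
`1`-type and by the reason for which they are in the pattern. -/
abbrev CopyCode (L : FirstOrder.Language.{0, 0}) : Type :=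
  OneType L ⊕ ((OneType L × Option (TwoType L × TwoType L)) × Fin 3 × TwoType L)

theorem exists_copyCode (hT : TransOn T A) : ∃ code : SmallUniverse T A → CopyCode L,
    ∀ e f, orig T f ∈ clique T (orig T e) → code e = code f → e = f := by
  have hex : ∀ c : A, c ∈ pattern T → ∃ r : Option (TwoType L × TwoType L),
      c = r.elim (kin T c) fun τ => kinWitness T (witness (kin T c) τ.1) (kin T c) τ.2 := by
    rintro c ⟨-, h | ⟨τ, τ', h⟩⟩
    · exact ⟨none, h⟩
    · exact ⟨some (τ, τ'), h⟩
  choose r hr using hex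
  refine ⟨Sum.map (fun a => tp1 a.1) (fun p => ((tp1 p.1.1, r _ p.1.2), p.2)), ?_⟩
  rintro (x | ⟨c, q⟩) (y | ⟨d, q'⟩) hcl h
  · simp only [Sum.map_inl, Sum.inl.injEq] at h
    exact congrArg Sum.inl (Subtype.ext (x.2 y.1 hcl h.symm).symm)
  · simp at h
  · simp at h
  · simp only [Sum.map_inr, Sum.inr.injEq, Prod.mk.injEq] at h
    obtain ⟨⟨h1, h2⟩, rfl⟩ := h
    have hk : kin T c.1 = kin T d.1 := (kin_congr hT hcl h1.symm).symm
    have : c = d := by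
      apply Subtype.ext
      rw [hr _ c.2, hr _ d.2, h2, hk]
    rw [this]

theorem card_copyCode_le (L : FirstOrder.Language.{0, 0}) [Finite (Σ n, L.Relations n)] :
    Nat.card (CopyCode L) ≤ 2 ^ (13 * sigSize L + 3) := by
  have h1 := card_oneType_le L
  have h2 := card_twoType_le L
  rw [Nat.card_sum, Nat.card_prod (_ × _), Nat.card_prod (OneType L) (Option _),
    Finite.card_option, Nat.card_prod (TwoType L), Nat.card_prod (Fin 3), Nat.card_fin]
  set n := sigSize L
  have e4 : (2 : ℕ) ^ (4 * n) = (2 ^ n) ^ 4 := by rw [mul_comm, pow_mul]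
  have e13 : (2 : ℕ) ^ (13 * n + 3) = (2 ^ n) ^ 13 * 8 := by
    rw [pow_add, mul_comm 13, pow_mul]; norm_num
  rw [e4] at h2
  rw [e13]
  have hpos : 1 ≤ 2 ^ n := Nat.one_le_two_pow
  generalize 2 ^ n = X at *
  calc _ ≤ X + X * (X ^ 4 * X ^ 4 + 1) * (3 * X ^ 4) := by gcongr
    _ = X + X ^ 13 * 3 + X ^ 5 * 3 := by ring
    _ ≤ X ^ 13 + X ^ 13 * 3 + X ^ 13 * 3 := by
      gcongr
      · exact Nat.le_self_pow (by norm_num) X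
      · norm_num
    _ ≤ X ^ 13 * 8 := by omega

end SmallClique

/-- The small clique property: a satisfiable normal-form sentence with transitive witnesses has a
model in which the cliques are exponentially bounded. All cliques are replaced at once. -/
theorem exists_model_cliquesBounded [L.IsRelational] [Finite (Σ n, L.Relations n)]
    (hL : IsUnaryBinary L) {T : L.Relations 2} {Ψ : NormalForm L} {A : Type} [L.Structure A]
    [Nonempty A] (hA : Ψ.IsModel T A) :
    ∃ (N : Type) (_ : L.Structure N), Nonempty N ∧ Ψ.IsModel T N ∧
      CliquesBounded T (2 ^ (13 * sigSize L + 3)) N := by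
  have hT := hA.1
  obtain ⟨S, h1, hG, hR, -⟩ := exists_glued_structure_of_requests (L := L) (orig T)
    (SmallGood T (A := A)) (SmallRequest T) WellOrderingRel
    (fun e f hef => ⟨fun h h' => asymm_of WellOrderingRel h h', fun h =>
      ((trichotomous_of WellOrderingRel e f).resolve_right
        (fun hc => hc.elim hef h))⟩)
    (fun e f x y h => ⟨h.2.2.1, h.2.2.2.1, h.1, h.2.1, h.2.2.2.2.symm⟩)
    (fun e f hef => exists_smallGood hef) (fun e f x y h => h.2.1)
    (fun e f z hef h => h.good hef) (fun e f z z' _ h h' => h.unique h')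
    (fun e f z z' _ h h' => h.eq_orig h')
  refine ⟨SmallUniverse T A, S, ?_, ?_, ?_⟩
  · obtain ⟨a⟩ := ‹Nonempty A›
    by_cases hk : King T a
    · exact ⟨Sum.inl ⟨a, hk⟩⟩
    · refine ⟨Sum.inr (⟨kin T a, fun hc => hk ?_, Or.inl (kin_kin hT a).symm⟩, 0, tp2 a a)⟩
      exact (hc.of_mem (mem_clique_symm (kin_spec a).1) (kin_spec a).2.symm).2
  · refine isModel_of_types hL hA ?_ (fun e f hef => ?_) (fun e => ?_)
    · intro e f g hef hfg
      by_cases h12 : e = f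
      · exact h12 ▸ hfg
      by_cases h23 : f = g
      · exact h23 ▸ hef
      obtain ⟨x, y, gxy, txy⟩ := hG e f h12
      obtain ⟨y', z, gyz, tyz⟩ := hG f g h23
      rw [tp2_rel txy] at hef
      rw [tp2_rel tyz] at hfg
      have hyy : y ∈ clique T y' :=
        mem_clique_trans hT (mem_clique_symm gyz.1) gxy.2.2.1
      have hxz : rel T x z := by
        rcases mem_clique_symm hyy with rfl | ⟨hy, -⟩
        · exact hT _ _ _ hef hfg
        · exact hT _ _ _ hef (hT _ _ _ hy hfg)
      by_cases h13 : e = g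
      · subst h13
        have hzx : x ∈ clique T z := mem_clique_trans hT (mem_clique_symm gyz.2.2.1) gxy.1
        have hxx : rel T x x := by
          rcases hzx with rfl | ⟨hzx, -⟩
          · exact hxz
          · exact hT _ _ _ hxz hzx
        exact (tp1_rel (h1 e) T).2 ((tp1_rel gxy.2.1 T).1 hxx)
      · obtain ⟨x', z', gxz, txz⟩ := hG e g h13
        rw [tp2_rel txz]
        exact rel_of_mem_clique hT (mem_clique_trans hT (mem_clique_symm gxy.1) gxz.1)
          (mem_clique_trans hT (mem_clique_symm gyz.2.2.1) gxz.2.2.1) hxz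
    · obtain ⟨x, y, h, ht⟩ := hG e f hef
      exact ⟨x, y, h.2.2.2.2, ht⟩
    · refine ⟨orig T e, h1 e, fun y hy => ?_⟩
      obtain ⟨f, z, hf, hr, ht⟩ := exists_smallRequest hT e hy
      exact ⟨f, hf, (hR e f z hf.symm hr).trans ht⟩
  · obtain ⟨code, hcode⟩ := exists_copyCode (A := A) hT
    intro e
    have hmem : ∀ f ∈ clique T e, orig T f ∈ clique T (orig T e) := by
      intro f hf
      by_cases hfe : f = e
      · exact hfe ▸ mem_clique_self _
      · obtain ⟨h2, h3⟩ := hf.resolve_left hfe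
        obtain ⟨x, y, g, t⟩ := hG e f (Ne.symm hfe)
        rw [tp2_rel t] at h2
        rw [tp2_rel' t] at h3
        exact mem_clique_trans hT (mem_clique_trans hT g.1 (Or.inr ⟨h2, h3⟩))
          (mem_clique_symm g.2.2.1)
    have hinj : Set.InjOn code (clique T e) := fun f hf f' hf' h =>
      hcode f f' (mem_clique_trans hT (mem_clique_symm (hmem f hf)) (hmem f' hf')) h
    calc (clique T e).encard = (code '' clique T e).encard := hinj.encard_image.symm
      _ ≤ (Set.univ : Set (CopyCode L)).encard := Set.encard_le_encard (Set.subset_univ _)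
      _ = (Nat.card (CopyCode L) : ℕ∞) := by
        rw [Set.encard_univ, ENat.card_eq_coe_natCard]
      _ ≤ _ := by exact_mod_cast card_copyCode_le L

/-! ### Counting splices -/

/-- The splices that `spliceCount` counts. -/
def boundedSplices [L.IsRelational] (T : L.Relations 2) (h : ℕ) : Set (Splice L) :=
  {t | ∃ (A : Type) (_ : L.Structure A),
    TransOn T A ∧ CliquesBounded T h A ∧ ∃ a : A, splice T a = t}

theorem exists_surjective_of_encard_le {A : Type} {B : Set A} {h : ℕ} (hB : B.Nonempty)
    (hh : B.encard ≤ h) : ∃ e : Fin h → B, Function.Surjective e := by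
  have hfin : B.Finite := Set.finite_of_encard_le_coe hh
  have := hfin.fintype
  have : Nonempty B := hB.to_subtype
  have hc : Fintype.card B ≤ Fintype.card (Fin h) := by
    rw [Set.encard_eq_coe_toFinset_card, Set.toFinset_card] at hh
    rw [Fintype.card_fin]
    exact_mod_cast hh
  obtain ⟨g⟩ := Function.Embedding.nonempty_of_card_le hc
  exact ⟨Function.invFun g, Function.invFun_surjective g.injective⟩

theorem exists_equiv_of_surjective {ι X Y : Type} {e : ι → X} {e' : ι → Y}
    (he : Function.Surjective e) (he' : Function.Surjective e')
    (hker : ∀ i j, e i = e j ↔ e' i = e' j) : ∃ f : X ≃ Y, ∀ i, f (e i) = e' i := by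
  have hf : ∀ i, e' (Function.surjInv he (e i)) = e' i := fun i =>
    (hker _ _).1 (Function.surjInv_eq he (e i))
  refine ⟨Equiv.ofBijective (fun x => e' (Function.surjInv he x)) ⟨?_, ?_⟩, hf⟩
  · intro x y hxy
    have := (hker _ _).2 hxy
    rwa [Function.surjInv_eq he, Function.surjInv_eq he] at this
  · intro y
    obtain ⟨i, rfl⟩ := he' y
    exact ⟨e i, hf i⟩

/-- Codes of splices of cliques with at most `h` elements: the kernel of an enumeration of the
clique by `Fin h`, the atoms that hold for the enumerated elements, and the two sets of
`1`-types. -/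
abbrev SpliceCode (L : FirstOrder.Language.{0, 0}) (h : ℕ) : Type :=
  Set (Fin h × Fin h) × ((Σ n, L.Relations n) → Set (Fin h × Fin h)) ×
    Set (OneType L) × Set (OneType L)

/-- The code of a splice for an enumeration of the clique. For a unary symbol, only the first
component of the pairs matters. -/
def spliceCode [L.IsRelational] {A : Type} [L.Structure A] (T : L.Relations 2) (a : A) {h : ℕ}
    (e : Fin h → clique T a) : SpliceCode L h :=
  ({p | e p.1 = e p.2},
    fun R => {p | Structure.RelMap R.2 fun t => if t.1 = 0 then e p.1 else e p.2},
    (splice T a).2)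

theorem splice_eq_of_spliceCode_eq [L.IsRelational] (hL : IsUnaryBinary L) {T : L.Relations 2}
    {h : ℕ} {A B : Type} [L.Structure A] [L.Structure B] {a : A} {b : B} {e : Fin h → clique T a}
    {e' : Fin h → clique T b} (he : Function.Surjective e) (he' : Function.Surjective e')
    (heq : spliceCode T a e = spliceCode T b e') : splice T a = splice T b := by
  simp only [spliceCode, Prod.mk.injEq] at heq
  obtain ⟨h1, h2, h3⟩ := heq
  refine Prod.ext (Quotient.sound ?_) h3
  obtain ⟨f, hf⟩ := exists_equiv_of_surjective he he' fun i j => Set.ext_iff.1 h1 (i, j)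
  refine ⟨⟨f, fun g => isEmptyElim g, ?_⟩⟩
  intro n R x
  have hx : ∃ i j, x = fun t => if t.1 = 0 then e i else e j := by
    rcases hL n ⟨R⟩ with rfl | rfl
    · obtain ⟨i, hi⟩ := he (x 0)
      refine ⟨i, i, funext fun t => ?_⟩
      fin_cases t
      exact hi.symm
    · obtain ⟨i, hi⟩ := he (x 0)
      obtain ⟨j, hj⟩ := he (x 1)
      refine ⟨i, j, funext fun t => ?_⟩
      fin_cases t
      · exact hi.symm
      · exact hj.symm
  obtain ⟨i, j, rfl⟩ := hx
  have hfx : (f ∘ fun t : Fin n => if t.1 = 0 then e i else e j) =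
      fun t => if t.1 = 0 then e' i else e' j := by
    funext t
    simp only [Function.comp_apply]
    split_ifs
    · exact hf i
    · exact hf j
  have := Set.ext_iff.1 (congrFun h2 ⟨n, R⟩) (i, j)
  simp only [Set.mem_ofPred_eq] at this
  change Structure.RelMap R (f ∘ _) ↔ _
  rw [hfx]
  exact this.symm

theorem exists_injOn_boundedSplices [L.IsRelational] (hL : IsUnaryBinary L) (T : L.Relations 2)
    (h : ℕ) : ∃ F : Splice L → SpliceCode L h, Set.InjOn F (boundedSplices T h) := by
  have hex : ∀ t : Splice L, ∃ c : SpliceCode L h, t ∈ boundedSplices T h →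
      ∃ (A : Type) (_ : L.Structure A) (a : A) (e : Fin h → clique T a),
        Function.Surjective e ∧ splice T a = t ∧ spliceCode T a e = c := by
    intro t
    by_cases ht : t ∈ boundedSplices T h
    · obtain ⟨A, S, -, hb, a, rfl⟩ := ht
      obtain ⟨e, he⟩ := exists_surjective_of_encard_le ⟨a, mem_clique_self a⟩ (hb a)
      exact ⟨_, fun _ => ⟨A, S, a, e, he, rfl, rfl⟩⟩
    · exact ⟨(∅, fun _ => ∅, ∅, ∅), fun hc => absurd hc ht⟩
  choose F hF using hex
  refine ⟨F, fun t ht t' ht' heq => ?_⟩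
  obtain ⟨A, S, a, e, he, rfl, hc⟩ := hF t ht
  obtain ⟨B, S', b, e', he', rfl, hc'⟩ := hF t' ht'
  exact splice_eq_of_spliceCode_eq hL he he' (hc.trans (heq.trans hc'.symm))

theorem finite_boundedSplices [L.IsRelational] [Finite (Σ n, L.Relations n)]
    (hL : IsUnaryBinary L) (T : L.Relations 2) (h : ℕ) : (boundedSplices T h).Finite := by
  obtain ⟨F, hF⟩ := exists_injOn_boundedSplices hL T h
  exact Set.Finite.of_finite_image (Set.toFinite _) hF

theorem spliceCount_le [L.IsRelational] [Finite (Σ n, L.Relations n)]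
    (hL : IsUnaryBinary L) (T : L.Relations 2) (h : ℕ) :
    spliceCount T h ≤ 2 ^ (h ^ 2 * (1 + sigSize L) + 2 * 2 ^ sigSize L) := by
  obtain ⟨F, hF⟩ := exists_injOn_boundedSplices hL T h
  have h1 : spliceCount T h ≤ Nat.card (SpliceCode L h) := by
    rw [← Set.ncard_univ]
    exact Set.ncard_le_ncard_of_injOn F (fun _ _ => Set.mem_univ _) hF
  have h2 : Nat.card (Set (Fin h × Fin h)) = 2 ^ (h ^ 2) := by
    rw [natCard_set, Nat.card_prod, Nat.card_fin, sq]
  have h3 : Nat.card (Set (OneType L)) ≤ 2 ^ 2 ^ sigSize L := by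
    rw [natCard_set]
    exact Nat.pow_le_pow_right (by norm_num) (card_oneType_le L)
  refine h1.trans ?_
  rw [Nat.card_prod (Set (Fin h × Fin h)), Nat.card_prod (_ → _), Nat.card_prod (Set (OneType L)),
    Nat.card_fun, h2]
  calc _ ≤ 2 ^ h ^ 2 * ((2 ^ h ^ 2) ^ sigSize L * (2 ^ 2 ^ sigSize L * 2 ^ 2 ^ sigSize L)) := by
        unfold sigSize at *
        gcongr
    _ = _ := by
        rw [← pow_mul, ← pow_add, ← pow_add, ← pow_add]
        congr 1
        ring

theorem segBound_le [L.IsRelational] [Finite (Σ n, L.Relations n)] (hL : IsUnaryBinary L)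
    (T : L.Relations 2) (Ψ : NormalForm L) :
    Ψ.segBound T (2 ^ (13 * sigSize L + 3)) ≤ (Ψ.m + 1) * 2 ^ 2 ^ (27 * sigSize L + 9) := by
  unfold NormalForm.segBound
  rw [mul_assoc]
  have hs := spliceCount_le hL T (2 ^ (13 * sigSize L + 3))
  set n := sigSize L
  refine Nat.mul_le_mul_left _ ?_
  calc _ ≤ (2 ^ ((2 ^ (13 * n + 3)) ^ 2 * (1 + n) + 2 * 2 ^ n)) ^ 2 * 2 ^ (13 * n + 3) := by gcongr
    _ = 2 ^ (((2 ^ (13 * n + 3)) ^ 2 * (1 + n) + 2 * 2 ^ n) * 2 + (13 * n + 3)) := by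
        rw [← pow_mul, ← pow_add]
    _ ≤ _ := Nat.pow_le_pow_right (by norm_num) ?_
  have hn : 1 + n ≤ 2 ^ n := by have := Nat.lt_two_pow_self (n := n); omega
  have hpos : 1 ≤ 2 ^ n := Nat.one_le_two_pow
  have e1 : (2 : ℕ) ^ (13 * n + 3) = (2 ^ n) ^ 13 * 8 := by
    rw [pow_add, mul_comm 13, pow_mul]; norm_num
  have e2 : (2 : ℕ) ^ (27 * n + 9) = (2 ^ n) ^ 27 * 512 := by
    rw [pow_add, mul_comm 27, pow_mul]; norm_num
  have hn' : 13 * n + 3 ≤ 13 * 2 ^ n := by omega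
  rw [e1, e2]
  generalize 2 ^ n = X at *
  have hX : X ≤ X ^ 27 := Nat.le_self_pow (by norm_num) X
  calc _ ≤ ((X ^ 13 * 8) ^ 2 * X + 2 * X) * 2 + 13 * X := by gcongr
    _ = X ^ 27 * 128 + 17 * X := by ring
    _ ≤ X ^ 27 * 512 := by omega

/-- The structure in which all atoms are true. -/
@[reducible] def fullStructure (L : FirstOrder.Language.{0, 0}) [L.IsRelational] (X : Type) :
    L.Structure X where
  funMap := fun f => isEmptyElim f
  RelMap := fun _ _ => True

/-- There are at least as many splices as sizes of cliques: in the full structures all elements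
form one clique. -/
theorem le_spliceCount [L.IsRelational] [Finite (Σ n, L.Relations n)] (hL : IsUnaryBinary L)
    (T : L.Relations 2) (h : ℕ) : h ≤ spliceCount T h := by
  let F : Fin h → boundedSplices T h := fun k =>
    letI := fullStructure L (Fin (k + 1))
    ⟨splice T (0 : Fin (k + 1)), Fin (k + 1), fullStructure L _, fun _ _ _ _ _ => trivial,
      fun a => (Set.encard_le_encard (Set.subset_univ _)).trans (by
        rw [Set.encard_univ, ENat.card_eq_coe_natCard, Nat.card_fin]
        exact_mod_cast k.2), 0, rfl⟩
  have hF : Function.Injective F := by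
    intro k k' hkk
    have h1 := Quotient.exact (congrArg Prod.fst (congrArg Subtype.val hkk))
    obtain ⟨g⟩ := h1
    have h2 := Nat.card_congr g.toEquiv
    have hc : ∀ j : ℕ, Nat.card (@clique L (Fin (j + 1)) (fullStructure L _) T 0) = j + 1 := by
      intro j
      have : @clique L (Fin (j + 1)) (fullStructure L _) T 0 = Set.univ :=
        Set.eq_univ_of_forall fun b => Or.inr ⟨trivial, trivial⟩
      rw [this, Nat.card_coe_set_eq, Set.ncard_univ, Nat.card_fin]
    have h3 := (hc k).symm.trans (h2.trans (hc k'))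
    exact Fin.ext (by omega)
  have := (finite_boundedSplices hL T h).to_subtype
  have h1 := Nat.card_le_card_of_injective F hF
  rw [Nat.card_fin] at h1
  exact h1

/-! ### Profiles of elements -/

section Profile

variable {A : Type} [L.Structure A] (T : L.Relations 2)

/-- The profile of an element: the `1`-types that occur in its clique, and those that occur below
its clique. -/
def profile (a : A) : Set (OneType L) × Set (OneType L) :=
  (tp1 '' clique T a, {t | ∃ b, below T b a ∧ tp1 b = t})

variable {T}

theorem profile_eq_of_splice_eq [L.IsRelational] (hT : TransOn T A) {a b : A}
    (h : splice T a = splice T b) : profile T a = profile T b := by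
  have hin : ∀ a : A, (profile T a).2 = (splice T a).2.1 := by
    intro a
    ext t
    constructor
    · rintro ⟨b, hb, rfl⟩
      exact ⟨b, fun c hc => below_of_mem_clique hT (mem_clique_self b) hc hb, rfl⟩
    · rintro ⟨b, hb, rfl⟩
      exact ⟨b, hb a (mem_clique_self a), rfl⟩
  obtain ⟨g⟩ := Quotient.exact (congrArg Prod.fst h)
  have g : clique T a ≃[L] clique T b := g
  have hg : ∀ x : clique T a, tp1 (L := L) (g x : A) = tp1 (x : A) := fun x =>
    tp2_fst (tp2_equiv g x x)
  refine Prod.ext ?_ (by rw [hin, hin, h])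
  ext t
  constructor
  · rintro ⟨x, hx, rfl⟩
    exact ⟨g ⟨x, hx⟩, (g ⟨x, hx⟩).2, hg ⟨x, hx⟩⟩
  · rintro ⟨y, hy, rfl⟩
    obtain ⟨x, hx⟩ := g.surjective ⟨y, hy⟩
    exact ⟨x, x.2, by rw [← hg x, hx]⟩

theorem card_range_profile_le [L.IsRelational] [Finite (Σ n, L.Relations n)]
    (hL : IsUnaryBinary L) (hT : TransOn T A) {h : ℕ} (hA : CliquesBounded T h A) :
    Nat.card (Set.range (profile T (A := A))) ≤ spliceCount T h := by
  have := (finite_boundedSplices hL T h).to_subtype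
  refine Nat.card_le_card_of_injective (β := boundedSplices T h)
    (fun t => ⟨splice T t.2.choose, A, _, hT, hA, _, rfl⟩) ?_
  intro t t' heq
  apply Subtype.ext
  rw [← t.2.choose_spec, ← t'.2.choose_spec]
  exact profile_eq_of_splice_eq hT (congrArg Subtype.val heq)

end Profile

/-! ### The order on profiles -/

/-- `t` is dominated by `u`: everything in or below a clique with profile `t` has a `1`-type that
occurs below cliques with profile `u`. -/
def Dominated (t u : Set (OneType L) × Set (OneType L)) : Prop := t.1 ⊆ u.2 ∧ t.2 ⊆ u.2

theorem Dominated.trans {t u v : Set (OneType L) × Set (OneType L)} (h : Dominated t u)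
    (h' : Dominated u v) : Dominated t v := ⟨h.1.trans h'.2, h.2.trans h'.2⟩

section Solitary

variable {A : Type} [L.Structure A] {T : L.Relations 2}

theorem profile_eq_of_mem_clique (hT : TransOn T A) {a b : A} (h : b ∈ clique T a) :
    profile T b = profile T a := by
  refine Prod.ext (by simp only [profile, clique_eq hT h]) (Set.ext fun t => ⟨?_, ?_⟩)
  · rintro ⟨c, hc, rfl⟩
    exact ⟨c, below_of_mem_clique hT (mem_clique_self c) (mem_clique_symm h) hc, rfl⟩
  · rintro ⟨c, hc, rfl⟩
    exact ⟨c, below_of_mem_clique hT (mem_clique_self c) h hc, rfl⟩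

theorem below.dominated (hT : TransOn T A) {a b : A} (h : below T a b) :
    Dominated (profile T a) (profile T b) := by
  constructor
  · rintro t ⟨c, hc, rfl⟩
    exact ⟨c, below_of_mem_clique hT hc (mem_clique_self b) h, rfl⟩
  · rintro t ⟨c, hc, rfl⟩
    exact ⟨c, ⟨hT _ _ _ hc.1 h.1, fun h' => hc.2 (hT _ _ _ h.1 h')⟩, rfl⟩

theorem Dominated.exists_below {a b : A} (h : Dominated (profile T a) (profile T b)) :
    ∃ a', below T a' b ∧ tp1 (L := L) a' = tp1 a := h.1 ⟨a, mem_clique_self a, rfl⟩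

theorem below.not_mem_clique {a b : A} (h : below T a b) : b ∉ clique T a := by
  rintro (rfl | h')
  · exact h.2 h.1
  · exact h.2 h'.2

theorem not_rel_of_not_dominated (hT : TransOn T A) {a b : A} (hab : b ∉ clique T a)
    (h : ¬ Dominated (profile T a) (profile T b)) : ¬ rel T a b := fun hr =>
  h (below.dominated hT ⟨hr, fun hr' => hab (Or.inr ⟨hr, hr'⟩)⟩)

variable (T)

/-- An element is solitary if no other clique has the profile of its clique, and that profile does
not dominate itself. The cliques of the other elements can be duplicated: into an ascending or
descending chain if the profile dominates itself, and into an antichain if two cliques share it. -/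
def Solitary (a : A) : Prop :=
  ¬ Dominated (profile T a) (profile T a) ∧ ∀ b, profile T b = profile T a → b ∈ clique T a

/-- A standard element for the profile of `a`. -/
noncomputable def std (a : A) : A :=
  @Classical.epsilon A ⟨a⟩ fun b => profile T b = profile T a

/-- An element of the standard clique for the profile of `a` that has the `1`-type of `a`. -/
noncomputable def rep (a : A) : A :=
  @Classical.epsilon A ⟨a⟩ fun b => b ∈ clique T (std T a) ∧ tp1 (L := L) b = tp1 a

/-- A standard element of the clique of `a`. -/
noncomputable def cliqueRep (a : A) : A := @Classical.epsilon A ⟨a⟩ fun b => b ∈ clique T a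

variable {T}

theorem Solitary.of_profile_eq (hT : TransOn T A) {a b : A} (ha : Solitary T a)
    (h : profile T b = profile T a) : Solitary T b := by
  refine ⟨h ▸ ha.1, fun c hc => ?_⟩
  rw [clique_eq hT (ha.2 b h)]
  exact ha.2 c (hc.trans h)

theorem profile_std (a : A) : profile T (std T a) = profile T a :=
  @Classical.epsilon_spec A (fun b => profile T b = profile T a) ⟨a, rfl⟩

theorem std_congr {a b : A} (h : profile T b = profile T a) : std T b = std T a := by
  unfold std
  rw [h]

theorem rep_spec (a : A) : rep T a ∈ clique T (std T a) ∧ tp1 (L := L) (rep T a) = tp1 a := by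
  have h : tp1 (L := L) a ∈ (profile T (std T a)).1 := by
    rw [profile_std]
    exact ⟨a, mem_clique_self a, rfl⟩
  obtain ⟨b, hb, hb'⟩ := h
  exact @Classical.epsilon_spec A
    (fun b => b ∈ clique T (std T a) ∧ tp1 (L := L) b = tp1 a) ⟨b, hb, hb'⟩

theorem profile_rep (hT : TransOn T A) (a : A) : profile T (rep T a) = profile T a :=
  (profile_eq_of_mem_clique hT (rep_spec a).1).trans (profile_std a)

theorem cliqueRep_mem (a : A) : cliqueRep T a ∈ clique T a :=
  @Classical.epsilon_spec A (fun b => b ∈ clique T a) ⟨a, mem_clique_self a⟩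

theorem cliqueRep_congr (hT : TransOn T A) {a b : A} (h : b ∈ clique T a) :
    cliqueRep T b = cliqueRep T a := by
  unfold cliqueRep
  rw [clique_eq hT h]

theorem mem_clique_of_cliqueRep_eq (hT : TransOn T A) {a b : A}
    (h : cliqueRep T b = cliqueRep T a) : b ∈ clique T a :=
  mem_clique_trans hT (cliqueRep_mem a) (h ▸ mem_clique_symm (cliqueRep_mem b))

/-- Two elements of which neither profile dominates the other have the `1`-types of two
incomparable elements, even if they lie in one clique, unless they are solitary. -/
theorem exists_incomparable (hT : TransOn T A) {a b : A}
    (h1 : ¬ Dominated (profile T a) (profile T b)) (h2 : ¬ Dominated (profile T b) (profile T a))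
    (h3 : b ∈ clique T a → ¬ Solitary T a) : ∃ x y : A, tp1 (L := L) x = tp1 a ∧
      tp1 (L := L) y = tp1 b ∧ x ≠ y ∧ ¬ rel T x y ∧ ¬ rel T y x := by
  obtain ⟨y, hy, hyb, hya⟩ : ∃ y, profile T y = profile T b ∧ tp1 (L := L) y = tp1 b ∧
      y ∉ clique T a := by
    by_cases hb : b ∈ clique T a
    · have hpb := profile_eq_of_mem_clique hT hb
      have hs : ∃ c, profile T c = profile T a ∧ c ∉ clique T a := by
        by_contra hc
        push Not at hc
        exact h3 hb ⟨by rw [hpb] at h1; exact h1, hc⟩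
      obtain ⟨c, hc, hca⟩ := hs
      have : tp1 (L := L) b ∈ (profile T c).1 := by
        rw [hc, ← hpb]
        exact ⟨b, mem_clique_self b, rfl⟩
      obtain ⟨y, hy, hyb⟩ := this
      exact ⟨y, (profile_eq_of_mem_clique hT hy).trans (hc.trans hpb.symm), hyb,
        fun h => hca (mem_clique_trans hT h (mem_clique_symm hy))⟩
    · exact ⟨b, rfl, rfl, hb⟩
  rw [← hy] at h1 h2
  refine ⟨a, y, rfl, hyb, ?_, not_rel_of_not_dominated hT hya h1,
    not_rel_of_not_dominated hT (fun h => hya (mem_clique_symm h)) h2⟩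
  rintro rfl
  exact hya (mem_clique_self _)

end Solitary

/-! ### Segments -/

section Segment

variable {A : Type} [L.Structure A] (T : L.Relations 2) {m : ℕ} (dir : Fin m → Dir)
  (fw : Fin m → A → A) (a₀ : A)

/-- The base of the zeroth segment: the solitary elements, the cliques of their witnesses, and one
more clique, so that the segment is not empty. -/
def baseSet : Set A :=
  {x | Solitary T x ∨ (∃ a, Solitary T a ∧ ∃ i, x ∈ clique T (fw i a)) ∨ x ∈ clique T a₀}

/-- The standard cliques for the profiles of elements that are not solitary. -/
def standardSet (A : Type) [L.Structure A] : Set A := {x | x ∈ clique T (std T x) ∧ ¬ Solitary T x}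

/-- The base, and the common pattern of the other segments: standard cliques, with one copy for
each conjunct that demands a witness. -/
abbrev Block : Type :=
  {x : A // x ∈ baseSet T fw a₀} ⊕ ({x : A // x ∈ standardSet T A} × Fin m)

/-- The base together with three copies of the pattern. -/
abbrev Segments : Type :=
  {x : A // x ∈ baseSet T fw a₀} ⊕ (({x : A // x ∈ standardSet T A} × Fin m) × Fin 3)

variable {T fw a₀}

namespace Block

/-- The element of which an element is a copy. -/
def orig : Block T fw a₀ → A := Sum.elim (fun x => x.1) (fun p => p.1.1)

/-- The index of the copy of a standard clique. -/
def idx : Block T fw a₀ → ℕ := Sum.elim (fun _ => 0) (fun p => p.2)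

/-- Whether the copies ascend from segment to segment. The copies for conjuncts that demand
witnesses above ascend, the copies for the other conjuncts descend. -/
def Ascends : Block T fw a₀ → Prop := Sum.elim (fun _ => True) (fun p => dir p.2 = .fwd)

/-- `z` is the chosen witness of `x`, and the given element is the copy of its representative that
is reserved for this demand. -/
def Serves : Block T fw a₀ → A → A → Prop
  | .inl _, _, _ => False
  | .inr (r, i), x, z => ¬ Solitary T (fw i x) ∧ r.1 = rep T (fw i x) ∧ z = fw i x

end Block

namespace Segments

/-- The position of an element in the base or in the pattern. -/
def block : Segments T fw a₀ → Block T fw a₀ := Sum.map id Prod.fst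

/-- The number of the segment: `0` for the base, and `1`, `2`, `3` for the copies of the pattern. -/
def level : Segments T fw a₀ → ℕ := Sum.elim (fun _ => 0) (fun p => p.2 + 1)

/-- The element of which an element is a copy. -/
abbrev orig (e : Segments T fw a₀) : A := e.block.orig

open Classical in
/-- The height of an element among elements with equivalent profiles. -/
noncomputable def height (e : Segments T fw a₀) : ℤ :=
  if e.block.Ascends dir then e.level else -e.level

/-- The key of the clique of an element. Equal keys mean equal cliques, and among cliques with
equivalent profiles the order is the order of the keys. -/
noncomputable def key [LinearOrder A] (e : Segments T fw a₀) : ℤ ×ₗ (A ×ₗ ℕ) :=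
  toLex (e.height dir, toLex (cliqueRep T e.orig, e.block.idx))

/-- The strict order on the cliques. -/
def Precedes [LinearOrder A] (e f : Segments T fw a₀) : Prop :=
  Dominated (profile T e.orig) (profile T f.orig) ∧
    (Dominated (profile T f.orig) (profile T e.orig) → e.key dir < f.key dir)

/-- The pairs of which `e, f` may be copies. -/
def Good [LinearOrder A] (e f : Segments T fw a₀) (x y : A) : Prop :=
  tp1 (L := L) x = tp1 e.orig ∧ tp1 (L := L) y = tp1 f.orig ∧ x ≠ y ∧
    (e.key dir = f.key dir → x = e.orig ∧ y = f.orig) ∧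
    (e.key dir ≠ f.key dir →
      (rel T x y ↔ e.Precedes dir f) ∧ (rel T y x ↔ f.Precedes dir e))

/-- The requests: comparable pairs in which one element is solitary are kept, and elements that are
not solitary request witnesses from later segments. -/
def Request [LinearOrder A] (e f : Segments T fw a₀) (z : A) : Prop :=
  (e.key dir ≠ f.key dir ∧ (Solitary T e.orig ∨ Solitary T f.orig) ∧
    (below T e.orig f.orig ∨ below T f.orig e.orig) ∧ z = f.orig) ∨
  (¬ Solitary T e.orig ∧ e.level < f.level ∧ f.block.Serves e.orig z)

variable {dir}

theorem ext {e f : Segments T fw a₀} (h : e.block = f.block) (h' : e.level = f.level) : e = f := by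
  rcases e with x | ⟨p, j⟩ <;> rcases f with y | ⟨q, k⟩
  · exact congrArg Sum.inl (Sum.inl.inj h)
  · exact absurd h (by simp [block])
  · exact absurd h (by simp [block])
  · have h1 : p = q := Sum.inr.inj h
    have h2 : (j : ℕ) + 1 = k + 1 := h'
    rw [h1, Fin.ext (Nat.succ.inj h2)]

theorem level_eq_zero_iff {e f : Segments T fw a₀} (h : e.block = f.block) :
    e.level = 0 ↔ f.level = 0 := by
  rcases e with x | ⟨p, j⟩ <;> rcases f with y | ⟨q, k⟩ <;> simp [level] <;>
    simp [block] at h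

theorem eq_inl_of_solitary {e : Segments T fw a₀} (h : Solitary T e.orig) : ∃ x, e = .inl x := by
  rcases e with x | ⟨p, j⟩
  · exact ⟨x, rfl⟩
  · exact absurd h p.1.2.2

theorem key_eq_iff [LinearOrder A] {e f : Segments T fw a₀} : e.key dir = f.key dir ↔
    e.height dir = f.height dir ∧ cliqueRep T e.orig = cliqueRep T f.orig ∧
      e.block.idx = f.block.idx := by
  unfold key
  rw [EmbeddingLike.apply_eq_iff_eq, Prod.mk.injEq, EmbeddingLike.apply_eq_iff_eq, Prod.mk.injEq]

theorem natAbs_height (e : Segments T fw a₀) : (e.height dir).natAbs = e.level := by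
  unfold height
  split_ifs <;> simp

theorem mem_clique_of_key_eq [LinearOrder A] (hT : TransOn T A) {e f : Segments T fw a₀}
    (h : e.key dir = f.key dir) : f.orig ∈ clique T e.orig :=
  mem_clique_of_cliqueRep_eq hT (key_eq_iff.1 h).2.1.symm

theorem eq_of_key_eq [LinearOrder A] {e f : Segments T fw a₀} (h : e.key dir = f.key dir)
    (ho : e.orig = f.orig) : e = f := by
  obtain ⟨h1, -, h3⟩ := key_eq_iff.1 h
  have hl : e.level = f.level := by rw [← natAbs_height (dir := dir), h1, natAbs_height]
  refine ext ?_ hl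
  rcases e with x | ⟨p, j⟩ <;> rcases f with y | ⟨q, k⟩
  · exact congrArg Sum.inl (Subtype.ext ho)
  · simp [level] at hl
  · simp [level] at hl
  · have h1 : p.1 = q.1 := Subtype.ext ho
    have h2 : p.2 = q.2 := Fin.ext h3
    exact congrArg Sum.inr (Prod.ext h1 h2)

/-- The copies of a clique with a solitary element are not multiplied. -/
theorem key_eq_of_solitary [LinearOrder A] (hT : TransOn T A) {e f : Segments T fw a₀}
    (h : Solitary T e.orig) (hc : f.orig ∈ clique T e.orig) : e.key dir = f.key dir := by
  have hf : Solitary T f.orig := h.of_profile_eq hT (profile_eq_of_mem_clique hT hc)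
  refine key_eq_iff.2 ?_
  obtain ⟨x, rfl⟩ := eq_inl_of_solitary h
  obtain ⟨y, rfl⟩ := eq_inl_of_solitary hf
  refine ⟨?_, (cliqueRep_congr hT hc).symm, rfl⟩
  simp [height, level]

theorem not_solitary_of_serves (hT : TransOn T A) {e : Segments T fw a₀} {x z : A}
    (h : e.block.Serves x z) : ¬ Solitary T e.orig := by
  rcases e with y | ⟨⟨r, i⟩, j⟩
  · exact h.elim
  · intro hs
    exact h.1 (hs.of_profile_eq hT (by
      rw [← profile_rep hT (fw i x), ← h.2.1]
      rfl))

section Order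

variable [LinearOrder A]

theorem key_lt_iff {e f : Segments T fw a₀} : e.key dir < f.key dir ↔
    e.height dir < f.height dir ∨ e.height dir = f.height dir ∧
      toLex (cliqueRep T e.orig, e.block.idx) < toLex (cliqueRep T f.orig, f.block.idx) :=
  Prod.Lex.lt_iff

theorem Precedes.asymm {e f : Segments T fw a₀} (h : e.Precedes dir f) : ¬ f.Precedes dir e :=
  fun h' => lt_asymm (h.2 h'.1) (h'.2 h.1)

theorem Precedes.trans {e f g : Segments T fw a₀} (h : e.Precedes dir f)
    (h' : f.Precedes dir g) : e.Precedes dir g :=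
  ⟨h.1.trans h'.1, fun hd => (h.2 (h'.1.trans hd)).trans (h'.2 (hd.trans h.1))⟩

theorem precedes_congr (hT : TransOn T A) {e e' f f' : Segments T fw a₀}
    (he : e.key dir = e'.key dir) (hf : f.key dir = f'.key dir) :
    e.Precedes dir f ↔ e'.Precedes dir f' := by
  unfold Precedes
  rw [he, hf, profile_eq_of_mem_clique hT (mem_clique_of_key_eq hT he),
    profile_eq_of_mem_clique hT (mem_clique_of_key_eq hT hf)]

theorem not_dominated_of_not_precedes {e f : Segments T fw a₀} (hk : e.key dir ≠ f.key dir)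
    (h : ¬ e.Precedes dir f) (h' : ¬ f.Precedes dir e) :
    ¬ Dominated (profile T e.orig) (profile T f.orig) := by
  intro hd
  have h1 : Dominated (profile T f.orig) (profile T e.orig) ∧ ¬ e.key dir < f.key dir := by
    by_contra hc
    exact h ⟨hd, fun hd' => by_contra fun hl => hc ⟨hd', hl⟩⟩
  exact h' ⟨h1.1, fun _ => lt_of_le_of_ne (not_lt.1 h1.2) hk.symm⟩

theorem Good.symm {e f : Segments T fw a₀} {x y : A} (h : Good dir e f x y) :
    Good dir f e y x :=
  ⟨h.2.1, h.1, h.2.2.1.symm, fun hk => (h.2.2.2.1 hk.symm).symm,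
    fun hk => (h.2.2.2.2 hk.symm).symm⟩

theorem exists_good (hT : TransOn T A) {e f : Segments T fw a₀} (hef : e ≠ f) :
    ∃ x y, Good dir e f x y := by
  by_cases hk : e.key dir = f.key dir
  · exact ⟨_, _, rfl, rfl, fun h => hef (eq_of_key_eq hk h), fun _ => ⟨rfl, rfl⟩,
      fun h => absurd hk h⟩
  have main : ∀ {e f : Segments T fw a₀}, e.key dir ≠ f.key dir → e.Precedes dir f →
      ∃ x y, Good dir e f x y := by
    intro e f hk h
    obtain ⟨x, hx, hxe⟩ := h.1.exists_below
    refine ⟨x, f.orig, hxe, rfl, ?_, fun h => absurd h hk, fun _ =>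
      ⟨iff_of_true hx.1 h, iff_of_false hx.2 h.asymm⟩⟩
    rintro rfl
    exact hx.2 hx.1
  by_cases h : e.Precedes dir f
  · exact main hk h
  by_cases h' : f.Precedes dir e
  · obtain ⟨x, y, hxy⟩ := main (Ne.symm hk) h'
    exact ⟨y, x, hxy.symm⟩
  · obtain ⟨x, y, hx, hy, hne, h1, h2⟩ := exists_incomparable hT
      (not_dominated_of_not_precedes hk h h')
      (not_dominated_of_not_precedes (Ne.symm hk) h' h)
      (fun hc hs => hk (key_eq_of_solitary hT hs hc))
    exact ⟨x, y, hx, hy, hne, fun h => absurd h hk, fun _ =>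
      ⟨iff_of_false h1 h, iff_of_false h2 h'⟩⟩

theorem precedes_of_below (hT : TransOn T A) {e f : Segments T fw a₀}
    (hs : Solitary T e.orig ∨ Solitary T f.orig) (h : below T e.orig f.orig) :
    e.Precedes dir f := by
  have hd := below.dominated hT h
  refine ⟨hd, fun hd' => ?_⟩
  rcases hs with hs | hs
  · exact absurd (hd.trans hd') hs.1
  · exact absurd (hd'.trans hd) hs.1

theorem good_of_below (hT : TransOn T A) {e f : Segments T fw a₀} (hk : e.key dir ≠ f.key dir)
    (hs : Solitary T e.orig ∨ Solitary T f.orig) (h : below T e.orig f.orig) :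
    Good dir e f e.orig f.orig := by
  have hp := precedes_of_below (dir := dir) hT hs h
  refine ⟨rfl, rfl, ?_, fun h => absurd h hk, fun _ =>
    ⟨iff_of_true h.1 hp, iff_of_false h.2 hp.asymm⟩⟩
  intro heq
  rw [heq] at h
  exact h.2 h.1

theorem Request.good (hT : TransOn T A)
    (hfw : ∀ i a, (dir i = .fwd ∧ below T a (fw i a)) ∨ (dir i = .bwd ∧ below T (fw i a) a))
    {e f : Segments T fw a₀} {z : A} (h : Request dir e f z) : Good dir e f e.orig z := by
  rcases h with ⟨hk, hs, hb | hb, rfl⟩ | ⟨hs, hl, hz⟩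
  · exact good_of_below hT hk hs hb
  · exact (good_of_below hT hk.symm hs.symm hb).symm
  · rcases f with y | ⟨⟨r, i⟩, j⟩
    · exact hz.elim
    obtain ⟨hs', hr, rfl⟩ := hz
    set f : Segments T fw a₀ := .inr ((r, i), j) with hf
    have hfo : f.orig = rep T (fw i e.orig) := hr
    have hpf : profile T f.orig = profile T (fw i e.orig) := by rw [hfo, profile_rep hT]
    have htf : tp1 (L := L) (fw i e.orig) = tp1 f.orig := by rw [hfo, (rep_spec _).2]
    have hk : e.key dir ≠ f.key dir := by
      intro h
      have h1 := (key_eq_iff.1 h).1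
      rw [← natAbs_height (dir := dir) e, ← natAbs_height (dir := dir) f, h1] at hl
      exact lt_irrefl _ hl
    have hhe := natAbs_height (dir := dir) e
    rcases hfw i e.orig with ⟨hd, hb⟩ | ⟨hd, hb⟩
    · have hh : f.height dir = f.level := if_pos hd
      have hp : e.Precedes dir f := by
        refine ⟨hpf ▸ below.dominated hT hb, fun _ => key_lt_iff.2 (Or.inl ?_)⟩
        omega
      refine ⟨rfl, htf, fun heq => hb.not_mem_clique (heq ▸ mem_clique_self _),
        fun h => absurd h hk, fun _ => ⟨iff_of_true hb.1 hp, iff_of_false hb.2 hp.asymm⟩⟩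
    · have hh : f.height dir = -f.level := if_neg fun h : dir i = .fwd => by
        rw [hd] at h
        cases h
      have hp : f.Precedes dir e := by
        refine ⟨hpf ▸ below.dominated hT hb, fun _ => key_lt_iff.2 (Or.inl ?_)⟩
        omega
      refine ⟨rfl, htf, fun heq => hb.not_mem_clique (heq ▸ mem_clique_self _),
        fun h => absurd h hk, fun _ => ⟨iff_of_false hb.2 hp.asymm, iff_of_true hb.1 hp⟩⟩

theorem Request.unique (hT : TransOn T A) {e f : Segments T fw a₀} {z z' : A}
    (h : Request dir e f z) (h' : Request dir e f z') : z = z' := by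
  rcases h with ⟨-, hs, -, hz⟩ | ⟨hs, -, hz⟩ <;> rcases h' with ⟨-, hs', -, hz'⟩ | ⟨hs', -, hz'⟩
  · rw [hz, hz']
  · exact (hs.elim hs' (not_solitary_of_serves hT hz')).elim
  · exact (hs'.elim hs (not_solitary_of_serves hT hz)).elim
  · rcases f with y | ⟨⟨r, i⟩, j⟩
    · exact hz.elim
    · exact hz.2.2.trans hz'.2.2.symm

theorem Request.eq_orig (hT : TransOn T A) {e f : Segments T fw a₀} {z z' : A}
    (h : Request dir e f z) (h' : Request dir f e z') : z = f.orig := by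
  rcases h with ⟨-, -, -, hz⟩ | ⟨hs, hl, hz⟩
  · exact hz
  · rcases h' with ⟨-, hs', -, -⟩ | ⟨-, hl', -⟩
    · exact (hs'.elim (not_solitary_of_serves hT hz) hs).elim
    · exact absurd hl hl'.asymm

/-- Whatever an element not in the last segment demands is requested from the base or from the next
segment. -/
theorem exists_request (hT : TransOn T A)
    (hfw : ∀ i a, (dir i = .fwd ∧ below T a (fw i a)) ∨ (dir i = .bwd ∧ below T (fw i a) a))
    (e : Segments T fw a₀) (he : e.level < 3) (i : Fin m) : ∃ f : Segments T fw a₀, f ≠ e ∧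
      (f.level = 0 ∨ f.level = e.level + 1) ∧ Request dir e f (fw i e.orig) := by
  have hb : below T e.orig (fw i e.orig) ∨ below T (fw i e.orig) e.orig :=
    (hfw i e.orig).imp And.right And.right
  have hnc : fw i e.orig ∉ clique T e.orig := by
    rcases hb with hb | hb
    · exact hb.not_mem_clique
    · exact fun h => hb.not_mem_clique (mem_clique_symm h)
  have main : ∀ hV : fw i e.orig ∈ baseSet T fw a₀, Solitary T e.orig ∨ Solitary T (fw i e.orig) →
      ∃ f : Segments T fw a₀, f ≠ e ∧ (f.level = 0 ∨ f.level = e.level + 1) ∧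
        Request dir e f (fw i e.orig) := by
    intro hV hs
    refine ⟨.inl ⟨_, hV⟩, ?_, Or.inl rfl, Or.inl ⟨?_, hs, hb, rfl⟩⟩
    · intro h
      have ho : fw i e.orig = e.orig := congrArg orig h
      exact hnc (by rw [ho]; exact mem_clique_self _)
    · intro h
      exact hnc (mem_clique_of_key_eq hT h)
  by_cases hs : Solitary T e.orig
  · exact main (Or.inr (Or.inl ⟨_, hs, i, mem_clique_self _⟩)) (Or.inl hs)
  by_cases hs' : Solitary T (fw i e.orig)
  · exact main (Or.inl hs') (Or.inr hs')
  · have hR : rep T (fw i e.orig) ∈ standardSet T A :=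
      ⟨by rw [std_congr (profile_rep hT _)]; exact (rep_spec _).1,
        fun h => hs' (h.of_profile_eq hT (profile_rep hT _).symm)⟩
    let f : Segments T fw a₀ := .inr ((⟨_, hR⟩, i), ⟨e.level, he⟩)
    have hf : f.level = e.level + 1 := rfl
    refine ⟨f, fun h => ?_, Or.inr hf, Or.inr ⟨hs, by omega, hs', rfl, rfl⟩⟩
    rw [h] at hf
    omega

/-- The relative position of two elements depends only on their positions in the base and in the
pattern and on the order of their segments. -/
theorem key_compare {e f e' f' : Segments T fw a₀} (he : e.block = e'.block)
    (hf : f.block = f'.block)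
    (hl : (e.level < f.level ∧ e'.level < f'.level) ∨ (e.level = f.level ∧ e'.level = f'.level)) :
    (e.key dir = f.key dir ↔ e'.key dir = f'.key dir) ∧
      (e.key dir < f.key dir ↔ e'.key dir < f'.key dir) ∧
      (f.key dir < e.key dir ↔ f'.key dir < e'.key dir) := by
  have h1 := level_eq_zero_iff he
  have hh : (e.height dir = f.height dir ↔ e'.height dir = f'.height dir) ∧
      (e.height dir < f.height dir ↔ e'.height dir < f'.height dir) ∧
      (f.height dir < e.height dir ↔ f'.height dir < e'.height dir) := by
    unfold height
    rw [he, hf]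
    split_ifs <;> omega
  have ho : e.orig = e'.orig := congrArg Block.orig he
  have ho' : f.orig = f'.orig := congrArg Block.orig hf
  simp only [key_eq_iff, key_lt_iff, he, hf, ho, ho', hh.1, hh.2.1, hh.2.2,
    eq_comm (a := f.height dir), eq_comm (a := f'.height dir), and_self]

end Order

end Segments

end Segment

/-! ### The size of the segments -/

theorem finite_and_card_le_of_subset_range {ι A : Type} [Finite ι] {B : Set A} (g : ι → A)
    (h : B ⊆ Set.range g) : B.Finite ∧ Nat.card B ≤ Nat.card ι := by
  have hr := Set.finite_range g
  refine ⟨hr.subset h, ?_⟩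
  calc Nat.card B ≤ Nat.card (Set.range g) := Nat.card_mono hr h
    _ ≤ Nat.card ι := Finite.card_range_le g

section Size

variable {A : Type} [L.Structure A] {T : L.Relations 2}

theorem exists_enumeration {h : ℕ} (hA : CliquesBounded T h A) (a : A) :
    ∃ e : Fin h → A, clique T a ⊆ Set.range e := by
  obtain ⟨e, he⟩ := exists_surjective_of_encard_le ⟨a, mem_clique_self (T := T) a⟩ (hA a)
  exact ⟨fun k => e k, fun b hb => by
    obtain ⟨k, hk⟩ := he ⟨b, hb⟩
    exact ⟨k, congrArg Subtype.val hk⟩⟩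

/-- The standard cliques of all profiles are at most as many as the profiles. -/
theorem card_standard_le [Finite (Σ n, L.Relations n)] {h : ℕ} (hA : CliquesBounded T h A) :
    {x : A | x ∈ clique T (std T x)}.Finite ∧
      Nat.card {x : A | x ∈ clique T (std T x)} ≤
        Nat.card (Set.range (profile T (A := A))) * h := by
  choose e he using exists_enumeration hA
  have := finite_and_card_le_of_subset_range (B := {x : A | x ∈ clique T (std T x)})
    (ι := Set.range (profile T (A := A)) × Fin h) (fun p => e (std T p.1.2.choose) p.2) (by
      intro x hx
      obtain ⟨k, hk⟩ := he _ hx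
      have hp : ∃ a, profile T a = profile T x := ⟨x, rfl⟩
      refine ⟨(⟨_, hp⟩, k), ?_⟩
      change e (std T hp.choose) k = x
      rw [std_congr hp.choose_spec]
      exact hk)
  rwa [Nat.card_prod, Nat.card_fin] at this

theorem Solitary.mem_standard {x : A} (hx : Solitary T x) : x ∈ clique T (std T x) :=
  mem_clique_symm (hx.2 _ (profile_std x))

theorem card_baseSet_le [Finite (Σ n, L.Relations n)] {h : ℕ} (hA : CliquesBounded T h A)
    {m : ℕ} (fw : Fin m → A → A) (a₀ : A) :
    (baseSet T fw a₀).Finite ∧ Nat.card (baseSet T fw a₀) ≤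
      Nat.card (Set.range (profile T (A := A))) * h * (1 + m * h) + h := by
  choose e he using exists_enumeration hA
  obtain ⟨hf, hc⟩ := card_standard_le (A := A) (T := T) hA
  have := hf.to_subtype
  have := finite_and_card_le_of_subset_range (B := baseSet T fw a₀)
    (ι := ({x : A | x ∈ clique T (std T x)} × (Unit ⊕ Fin m × Fin h)) ⊕ Fin h)
    (Sum.elim (fun p => Sum.elim (fun _ => p.1.1) (fun q => e (fw q.1 p.1) q.2) p.2) (e a₀)) (by
      rintro x (hx | ⟨a, ha, i, hx⟩ | hx)
      · exact ⟨.inl (⟨x, hx.mem_standard⟩, .inl ()), rfl⟩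
      · obtain ⟨k, hk⟩ := he _ hx
        exact ⟨.inl (⟨a, ha.mem_standard⟩, .inr (i, k)), hk⟩
      · obtain ⟨k, hk⟩ := he _ hx
        exact ⟨.inr k, hk⟩)
  refine ⟨this.1, this.2.trans ?_⟩
  rw [Nat.card_sum, Nat.card_prod, Nat.card_sum, Nat.card_prod, Nat.card_fin, Nat.card_fin,
    Nat.card_unique (α := Unit)]
  gcongr

theorem card_standardSet_le [Finite (Σ n, L.Relations n)] {h : ℕ} (hA : CliquesBounded T h A) :
    (standardSet T A).Finite ∧
      Nat.card (standardSet T A) ≤ Nat.card (Set.range (profile T (A := A))) * h := by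
  obtain ⟨hf, hc⟩ := card_standard_le (A := A) (T := T) hA
  have hsub : standardSet T A ⊆ {x : A | x ∈ clique T (std T x)} := fun x hx => hx.1
  exact ⟨hf.subset hsub, (Nat.card_mono hf hsub).trans hc⟩

theorem card_segments_le [L.IsRelational] [Finite (Σ n, L.Relations n)] (hL : IsUnaryBinary L)
    (hT : TransOn T A) {h : ℕ} (hA : CliquesBounded T h A) (Ψ : NormalForm L)
    (fw : Fin Ψ.m → A → A) (a₀ : A) : Finite (Segments T fw a₀) ∧
      Nat.card (Segments T fw a₀) ≤ 4 * Ψ.segBound T h := by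
  obtain ⟨hf1, hc1⟩ := card_baseSet_le hA fw a₀
  obtain ⟨hf2, hc2⟩ := card_standardSet_le (A := A) (T := T) hA
  have hs := card_range_profile_le (A := A) hL hT hA
  have hle := le_spliceCount hL T h
  have := hf1.to_subtype
  have := hf2.to_subtype
  have hi1 : Finite {x : A // x ∈ baseSet T fw a₀} := hf1.to_subtype
  have hi2 : Finite {x : A // x ∈ standardSet T A} := hf2.to_subtype
  refine ⟨inferInstance, ?_⟩
  unfold NormalForm.segBound
  have hcard : Nat.card (Segments T fw a₀) =
      Nat.card (baseSet T fw a₀) + Nat.card (standardSet T A) * Ψ.m * 3 := by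
    rw [Nat.card_sum, Nat.card_prod, Nat.card_prod, Nat.card_fin, Nat.card_fin]
  rw [hcard]
  generalize spliceCount T h = s at *
  generalize Ψ.m = m at *
  refine (Nat.add_le_add (hc1.trans (Nat.add_le_add_right (Nat.mul_le_mul_right (1 + m * h)
    (Nat.mul_le_mul_right h hs)) h)) (Nat.mul_le_mul_right 3
    (Nat.mul_le_mul_right m (hc2.trans (Nat.mul_le_mul_right h hs))))).trans ?_
  -- The summand `s * h * (m * h)` for the cliques of witnesses is absorbed because `h ≤ s`.
  rcases Nat.eq_zero_or_pos h with rfl | hpos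
  · simp
  have h1 : 1 ≤ s := le_trans hpos hle
  calc s * h * (1 + m * h) + h + s * h * m * 3 = h * (s * 1 + m * (s * h) + 1 * 1 + 3 * m * (s * 1))
        := by ring
    _ ≤ h * (s * s + m * (s * s) + s * s + 3 * m * (s * s)) := by gcongr
    _ ≤ h * (s * s + m * (s * s) + s * s + 3 * m * (s * s) + 2 * (s * s)) := by
        exact Nat.mul_le_mul_left _ (Nat.le_add_right _ _)
    _ = 4 * ((m + 1) * s ^ 2 * h) := by ring

end Size

/-! ### The structure on the segments -/

namespace Segments

variable {A : Type} [L.Structure A] {T : L.Relations 2} {m : ℕ} {fw : Fin m → A → A} {a₀ : A}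

/-- The element of segment `k + 1` in the same position. -/
def shift (k : Fin 3) : Segments T fw a₀ → Segments T fw a₀ := Sum.map id fun p => (p.1, k)

theorem block_shift (k : Fin 3) (e : Segments T fw a₀) : (e.shift k).block = e.block := by
  cases e <;> rfl

theorem level_shift (k : Fin 3) {e : Segments T fw a₀} (he : e.level ≠ 0) :
    (e.shift k).level = k + 1 := by
  rcases e with x | p
  · exact absurd rfl he
  · rfl

/-- The bijection of two segments other than the base. -/
def shiftEquiv (j k : Fin 3) : {e : Segments T fw a₀ | e.level = j + 1} ≃
    {e : Segments T fw a₀ | e.level = k + 1} where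
  toFun e := ⟨e.1.shift k, level_shift k (by rw [e.2]; omega)⟩
  invFun e := ⟨e.1.shift j, level_shift j (by rw [e.2]; omega)⟩
  left_inv e := by
    have h : e.1.level = j + 1 := e.2
    refine Subtype.ext (ext (by rw [block_shift, block_shift]) ?_)
    rw [level_shift, h]
    rw [level_shift] <;> omega
  right_inv e := by
    have h : e.1.level = k + 1 := e.2
    refine Subtype.ext (ext (by rw [block_shift, block_shift]) ?_)
    rw [level_shift, h]
    rw [level_shift] <;> omega

theorem block_shiftEquiv (j k : Fin 3) (e : {e : Segments T fw a₀ | e.level = j + 1}) :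
    (shiftEquiv j k e).1.block = e.1.block := block_shift _ _

/-- The order in which pairs of elements are given their `2`-types. -/
def Before (e f : Segments T fw a₀) : Prop :=
  e.level < f.level ∨ e.level = f.level ∧ WellOrderingRel e.block f.block

theorem before_iff {e f : Segments T fw a₀} (hef : e ≠ f) : e.Before f ↔ ¬ f.Before e := by
  unfold Before
  rcases lt_trichotomy e.level f.level with h | h | h
  · exact iff_of_true (Or.inl h) (by omega)
  · have hb : e.block ≠ f.block := fun hb => hef (ext hb h)
    simp only [h, lt_irrefl, true_and, false_or]
    exact ⟨fun h h' => asymm_of WellOrderingRel h h', fun h =>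
      ((trichotomous_of WellOrderingRel e.block f.block).resolve_right fun hc => hc.elim hb h)⟩
  · exact iff_of_false (by omega) (not_not.2 (Or.inl h))

/-- The structure on the segments: `2`-types come from the given structure, witnesses within cliques
and witnesses chosen by `fw` are found again, the latter in the base or in the next segment, and the
`2`-type of a pair depends only on the positions of its elements and the order of their segments. -/
theorem exists_structure [L.IsRelational] {dir : Fin m → Dir} (hT : TransOn T A)
    (hfw : ∀ i a, (dir i = .fwd ∧ below T a (fw i a)) ∨ (dir i = .bwd ∧ below T (fw i a) a)) :
    ∃ _ : L.Structure (Segments T fw a₀),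
      TransOn T (Segments T fw a₀) ∧
      (∀ e : Segments T fw a₀, tp1 (L := L) e = tp1 e.orig) ∧
      (∀ e f : Segments T fw a₀, e ≠ f → ∃ x y : A, x ≠ y ∧ tp2 (L := L) e f = tp2 x y) ∧
      (∀ (e : Segments T fw a₀) (y : A), y ∈ clique T e.orig → y ≠ e.orig →
        ∃ f, f ≠ e ∧ tp2 (L := L) e f = tp2 e.orig y) ∧
      (∀ (e : Segments T fw a₀) (i : Fin m), e.level < 3 → ∃ f : Segments T fw a₀, f ≠ e ∧
        (f.level = 0 ∨ f.level = e.level + 1) ∧ tp2 (L := L) e f = tp2 e.orig (fw i e.orig)) ∧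
      (∀ e f e' f' : Segments T fw a₀, e.block = e'.block → f.block = f'.block →
        ((e.level < f.level ∧ e'.level < f'.level) ∨
          (e.level = f.level ∧ e'.level = f'.level)) → tp2 (L := L) e f = tp2 e' f') := by
  let _ : LinearOrder A := IsWellOrder.linearOrder WellOrderingRel
  obtain ⟨S, h1, hG, hR, hloc⟩ := exists_glued_structure_of_requests (L := L)
    (orig (T := T) (fw := fw) (a₀ := a₀)) (Good dir) (Request dir) Before
    (fun e f hef => before_iff hef) (fun e f x y h => h.symm) (fun e f hef => exists_good hT hef)
    (fun e f x y h => h.1) (fun e f z _ h => h.good hT hfw) (fun e f z z' _ h h' => h.unique hT h')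
    (fun e f z z' _ h h' => h.eq_orig hT h')
  have hkey : ∀ e f : Segments T fw a₀, e ≠ f → e.key dir = f.key dir →
      tp2 (L := L) e f = tp2 e.orig f.orig := by
    intro e f hef hk
    obtain ⟨x, y, h, ht⟩ := hG e f hef
    obtain ⟨rfl, rfl⟩ := h.2.2.2.1 hk
    exact ht
  have hprec : ∀ e f : Segments T fw a₀, e.key dir ≠ f.key dir →
      (rel T e f ↔ e.Precedes dir f) := by
    intro e f hk
    obtain ⟨x, y, h, ht⟩ := hG e f (fun h => hk (congrArg _ h))
    exact (tp2_rel ht T).trans (h.2.2.2.2 hk).1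
  have hrel : ∀ e f : Segments T fw a₀, e ≠ f → e.key dir = f.key dir → rel T e f := by
    intro e f hef hk
    rw [tp2_rel (hkey e f hef hk)]
    rcases mem_clique_of_key_eq hT hk with h | h
    · exact absurd (eq_of_key_eq hk h.symm) hef
    · exact h.1
  refine ⟨S, ?_, h1, ?_, ?_, ?_, ?_⟩
  · intro e f g hef hfg
    by_cases h12 : e = f
    · exact h12 ▸ hfg
    by_cases h23 : f = g
    · exact h23 ▸ hef
    by_cases k12 : e.key dir = f.key dir
    · by_cases h13 : e = g
      · subst h13
        rw [tp2_rel (hkey e f h12 k12)] at hef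
        rw [tp2_rel (hkey f e h23 k12.symm)] at hfg
        exact (tp1_rel (h1 e) T).2 (hT _ _ _ hef hfg)
      · by_cases k23 : f.key dir = g.key dir
        · exact hrel e g h13 (k12.trans k23)
        · rw [hprec f g k23] at hfg
          rw [hprec e g (k12.trans_ne k23)]
          exact (precedes_congr hT k12 rfl).2 hfg
    · rw [hprec e f k12] at hef
      by_cases k23 : f.key dir = g.key dir
      · rw [hprec e g fun h => k12 (h.trans k23.symm)]
        exact (precedes_congr hT rfl k23).1 hef
      · rw [hprec f g k23] at hfg
        rw [hprec e g]
        · exact hef.trans hfg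
        · intro k13
          exact hef.asymm ((precedes_congr hT rfl k13).2 hfg)
  · intro e f hef
    obtain ⟨x, y, h, ht⟩ := hG e f hef
    exact ⟨x, y, h.2.2.1, ht⟩
  · intro e y hy hye
    have hmk : ∀ f : Segments T fw a₀, e.height dir = f.height dir → f.orig = y →
        e.block.idx = f.block.idx → ∃ f, f ≠ e ∧ tp2 (L := L) e f = tp2 e.orig y := by
      intro f hh ho hi
      have hk : e.key dir = f.key dir := key_eq_iff.2 ⟨hh, by rw [ho, cliqueRep_congr hT hy], hi⟩
      have hne : f ≠ e := fun h => hye (by rw [← ho, h])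
      exact ⟨f, hne, ho ▸ hkey e f hne.symm hk⟩
    rcases e with x | ⟨⟨r, i⟩, j⟩
    · have hyV : y ∈ baseSet T fw a₀ := by
        rcases x.2 with h | ⟨a, ha, i, h⟩ | h
        · exact Or.inl (h.of_profile_eq hT (profile_eq_of_mem_clique hT hy))
        · exact Or.inr (Or.inl ⟨a, ha, i, mem_clique_trans hT h hy⟩)
        · exact Or.inr (Or.inr (mem_clique_trans hT h hy))
      exact hmk (.inl ⟨y, hyV⟩) (by simp [height, level]) rfl rfl
    · have hp : profile T y = profile T r.1 := profile_eq_of_mem_clique hT hy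
      have hyR : y ∈ standardSet T A :=
        ⟨std_congr hp ▸ mem_clique_trans hT r.2.1 hy,
          fun h => r.2.2 (h.of_profile_eq hT hp.symm)⟩
      exact hmk (.inr ((⟨y, hyR⟩, i), j)) rfl rfl rfl
  · intro e i he
    obtain ⟨f, hf, hl, hr⟩ := exists_request (dir := dir) hT hfw e he i
    exact ⟨f, hf, hl, hR e f _ hf.symm hr⟩
  · intro e f e' f' he hf hl
    have ho : e.orig = e'.orig := congrArg Block.orig he
    have ho' : f.orig = f'.orig := congrArg Block.orig hf
    by_cases hef : e = f
    · subst hef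
      have : e' = f' := ext (he.symm.trans hf) (by omega)
      subst this
      exact tp2_self (by rw [h1, h1, ho])
    · have hef' : e' ≠ f' := by
        rintro rfl
        exact hef (ext (he.trans hf.symm) (by omega))
      obtain ⟨hk1, hk2, hk3⟩ := key_compare (dir := dir) he hf hl
      have hl1 : e.level < f.level ↔ e'.level < f'.level := by omega
      have hl2 : f.level < e.level ↔ f'.level < e'.level := by omega
      have hl3 : e.level = f.level ↔ e'.level = f'.level := by omega
      refine hloc e f e' f' hef hef' ho ho' ?_ ?_ ?_ ?_
      · intro x y
        simp only [Good, Precedes, ho, ho', hk1, hk2, hk3, ne_eq]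
      · intro z
        simp only [Request, ho, ho', hk1, hl1, hf, ne_eq]
      · intro z
        simp only [Request, ho, ho', eq_comm (a := f.key dir), eq_comm (a := f'.key dir), hk1, hl2,
          he, ne_eq]
      · simp only [Before, he, hf, hl1, hl3]

end Segments

/-- A model with bounded cliques yields a finite structure of base and three equivalent segments,
which is small and finds all witnesses within the base and the next segment. -/
theorem exists_segments [L.IsRelational] [Finite (Σ n, L.Relations n)] (hL : IsUnaryBinary L)
    {T : L.Relations 2} {Ψ : NormalForm L} {h : ℕ} {A : Type} [L.Structure A] [Nonempty A]
    (hA : Ψ.IsModel T A) (hb : CliquesBounded T h A) :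
    ∃ (N : Type) (_ : L.Structure N) (S : Fin 4 → Set N),
      Nonempty N ∧
      (Finite N ∧ Nat.card N ≤ 4 * Ψ.segBound T h) ∧
      ((S 0 = Set.univ ∧ S 1 = ∅ ∧ S 2 = ∅ ∧ S 3 = ∅) ∨
        (IsPartition S ∧ EquivalentConnections L S)) ∧
      (∀ a b : N, Holds Ψ.ψ₀.1 a b) ∧
      TransOn T N ∧
      (∀ j : Fin 3, ∀ a ∈ S j.castSucc, ∀ i : Fin Ψ.m,
        Ψ.W T i a ∩ S 0 = ∅ → (Ψ.W T i a ∩ S j.succ).Nonempty) ∧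
      (∀ a : N, ∀ i : Fin Ψ.m', ∃ b ∈ clique T a, Holds (Ψ.δ T i) a b) := by
  obtain ⟨hT, h0, hγ, hδ⟩ := (Ψ.isModel_iff T A).1 hA
  choose fw hfw using hγ
  obtain ⟨a₀⟩ := ‹Nonempty A›
  obtain ⟨S, hTN, h1, hpair, hcl, hwit, hloc⟩ := Segments.exists_structure (a₀ := a₀) hT
    (fun i a => NormalForm.below_of_holds_γ (hfw i a))
  obtain ⟨hfin, hcard⟩ := card_segments_le hL hT hb Ψ fw a₀
  have hbase : a₀ ∈ baseSet T fw a₀ := Or.inr (Or.inr (mem_clique_self a₀))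
  refine ⟨Segments T fw a₀, S, fun k => {e | e.level = k}, ⟨.inl ⟨a₀, hbase⟩⟩, ⟨hfin, hcard⟩, ?_,
    ?_, hTN, ?_, ?_⟩
  · by_cases hP : Nonempty ({x : A // x ∈ standardSet T A} × Fin Ψ.m)
    · obtain ⟨p⟩ := hP
      refine Or.inr ⟨⟨?_, ?_, ?_⟩, ?_⟩
      · intro k
        rcases Fin.eq_zero_or_eq_succ k with rfl | ⟨j, rfl⟩
        · exact ⟨.inl ⟨a₀, hbase⟩, rfl⟩
        · exact ⟨.inr (p, j), rfl⟩
      · intro j k hjk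
        rw [Set.disjoint_left]
        intro e hj hk
        exact hjk (Fin.ext (hj.symm.trans hk))
      · refine Set.eq_univ_of_forall fun e => Set.mem_iUnion.2 ?_
        rcases e with x | ⟨q, j⟩
        · exact ⟨0, rfl⟩
        · exact ⟨j.succ, rfl⟩
      · have hequiv : ∀ k : Fin 3, ∃ f : {e : Segments T fw a₀ | e.level = (0 : Fin 3) + 1} ≃[L]
            {e : Segments T fw a₀ | e.level = k + 1},
            ∀ x, f x = Segments.shiftEquiv 0 k x := fun k =>
          exists_equiv_of_tp2 hL _ fun a b => hloc _ _ _ _ (Segments.block_shiftEquiv 0 k a).symm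
            (Segments.block_shiftEquiv 0 k b).symm (Or.inr ⟨a.2.trans b.2.symm,
              (Segments.shiftEquiv 0 k a).2.trans (Segments.shiftEquiv 0 k b).2.symm⟩)
        obtain ⟨f, hf⟩ := hequiv 1
        obtain ⟨g, hg⟩ := hequiv 2
        have hfb : ∀ x, (f x).1.block = x.1.block := fun x => by
          rw [hf]
          exact Segments.block_shiftEquiv 0 1 x
        have hgb : ∀ x, (g x).1.block = x.1.block := fun x => by
          rw [hg]
          exact Segments.block_shiftEquiv 0 2 x
        have hfb' : ∀ x, (f.symm x).1.block = x.1.block := fun x => by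
          rw [← hfb, FirstOrder.Language.Equiv.apply_symm_apply]
        have hgf : ∀ x, (g.comp f.symm x).1.block = x.1.block := fun x => by
          rw [FirstOrder.Language.Equiv.comp_apply, hgb, hfb']
        have hlt : ∀ {i j i' j' : ℕ} {a b a' b' : Segments T fw a₀}, a.level = i → b.level = j →
            a'.level = i' → b'.level = j' → i < j → i' < j' →
            a.level < b.level ∧ a'.level < b'.level := by
          intros
          omega
        refine ⟨f, g, fun b c => ?_, fun b c => ?_, fun b c => ?_, fun b c => ?_⟩
        · exact hloc _ _ _ _ rfl (hfb c).symm
            (Or.inl (hlt b.2 c.2 b.2 (f c).2 (by decide) (by decide)))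
        · exact hloc _ _ _ _ rfl (hgb c).symm
            (Or.inl (hlt b.2 c.2 b.2 (g c).2 (by decide) (by decide)))
        · exact hloc _ _ _ _ (hfb b).symm (hgf c).symm
            (Or.inl (hlt b.2 c.2 (f b).2 (g.comp f.symm c).2 (by decide) (by decide)))
        · exact hloc _ _ _ _ rfl (hgf c).symm
            (Or.inl (hlt b.2 c.2 b.2 (g.comp f.symm c).2 (by decide) (by decide)))
    -- If the pattern is empty, the base is everything.
    · have hlev : ∀ e : Segments T fw a₀, e.level = 0 := by
        rintro (x | ⟨q, j⟩)
        · rfl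
        · exact absurd ⟨q⟩ hP
      have hemp : ∀ k : Fin 4, k ≠ 0 → {e : Segments T fw a₀ | e.level = k} = ∅ := fun k hk =>
        Set.eq_empty_of_forall_notMem fun e he => hk (Fin.ext (he.symm.trans (hlev e)))
      exact Or.inl ⟨Set.eq_univ_of_forall hlev, hemp 1 (by decide), hemp 2 (by decide),
        hemp 3 (by decide)⟩
  · intro e f
    by_cases hef : e = f
    · subst hef
      exact (holds_iff hL (by simp) (tp2_self (h1 e)) Ψ.ψ₀.2).2 (h0 _ _)
    · obtain ⟨x, y, hxy, ht⟩ := hpair e f hef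
      exact (holds_iff hL (iff_of_false hef hxy) ht Ψ.ψ₀.2).2 (h0 x y)
  · intro j e he i hemp
    have he' : e.level = j := he
    obtain ⟨f, hf, hl, ht⟩ := hwit e i (by omega)
    have hW : f ∈ Ψ.W T i e :=
      ⟨(holds_iff hL (iff_of_false hf.symm (NormalForm.ne_of_holds_γ (hfw i e.orig))) ht
        (Ψ.isQF_γ T i)).2 (hfw i e.orig), hf.symm⟩
    rcases hl with hl | hl
    · exact absurd (hemp ▸ ⟨hW, hl⟩ : f ∈ (∅ : Set (Segments T fw a₀))) (Set.notMem_empty f)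
    · exact ⟨f, hW, hl.trans (by rw [he']; rfl)⟩
  · intro e i
    obtain ⟨y, hy⟩ := hδ i e.orig
    have hex : ∃ f, Holds (Ψ.δ T i) e f := by
      by_cases hye : y = e.orig
      · subst hye
        exact ⟨e, (holds_iff hL (by simp) (tp2_self (h1 e)) (Ψ.isQF_δ T i)).2 hy⟩
      · obtain ⟨f, hf, ht⟩ := hcl e y (NormalForm.mem_clique_of_holds_δ hy) hye
        exact ⟨f, (holds_iff hL (iff_of_false hf.symm (Ne.symm hye)) ht (Ψ.isQF_δ T i)).2 hy⟩
    obtain ⟨f, hf⟩ := hex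
    exact ⟨f, NormalForm.mem_clique_of_holds_δ hf, hf⟩

/-! ### Repeating a segment infinitely often -/

/-- The levels of any three elements embed into three levels. -/
theorem exists_rank (a b c : ℕ) : ∃ r : ℕ → Fin 3, ∀ j ∈ ({a, b, c} : Finset ℕ),
    ∀ k ∈ ({a, b, c} : Finset ℕ), j < k → r j < r k := by
  set J : Finset ℕ := {a, b, c} with hJ
  have hcard : J.card ≤ 3 := Finset.card_le_three
  have hlt : ∀ j ∈ J, (J.filter (· < j)).card < 3 := fun j hj =>
    lt_of_lt_of_le (Finset.card_lt_card (Finset.filter_ssubset.2 ⟨j, hj, lt_irrefl j⟩)) hcard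
  refine ⟨fun j => if h : j ∈ J then ⟨_, hlt j h⟩ else 0, fun j hj k hk hjk => ?_⟩
  simp only [dif_pos hj, dif_pos hk, Fin.mk_lt_mk]
  refine Finset.card_lt_card (Finset.ssubset_iff_of_subset ?_ |>.2 ⟨j, ?_, ?_⟩)
  · exact Finset.monotone_filter_right _ fun x _ hx => lt_trans hx hjk
  · exact Finset.mem_filter.2 ⟨hj, hjk⟩
  · exact fun h => lt_irrefl j (Finset.mem_filter.1 h).2

section Repeat

variable [L.IsRelational] {A : Type} [L.Structure A] {S : Fin 4 → Set A}

/-- The copies of an element of the first segment in the three segments. -/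
def segmentCopy (f : S 1 ≃[L] S 2) (g : S 1 ≃[L] S 3) : Fin 3 → S 1 → A
  | 0, p => p
  | 1, p => f p
  | 2, p => g p

theorem segmentCopy_mem (f : S 1 ≃[L] S 2) (g : S 1 ≃[L] S 3) (k : Fin 3) (p : S 1) :
    segmentCopy f g k p ∈ S k.succ := by
  fin_cases k
  · exact p.2
  · exact (f p).2
  · exact (g p).2

theorem exists_segmentCopy_eq (f : S 1 ≃[L] S 2) (g : S 1 ≃[L] S 3) {k : Fin 3} {b : A}
    (hb : b ∈ S k.succ) : ∃ p, segmentCopy f g k p = b := by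
  fin_cases k
  · exact ⟨⟨b, hb⟩, rfl⟩
  · obtain ⟨p, hp⟩ := f.surjective ⟨b, hb⟩
    exact ⟨p, congrArg Subtype.val hp⟩
  · obtain ⟨p, hp⟩ := g.surjective ⟨b, hb⟩
    exact ⟨p, congrArg Subtype.val hp⟩

theorem segmentCopy_injective (f : S 1 ≃[L] S 2) (g : S 1 ≃[L] S 3) (k : Fin 3) :
    Function.Injective (segmentCopy f g k) := by
  intro p q h
  fin_cases k
  · exact Subtype.ext h
  · exact f.injective (Subtype.ext h)
  · exact g.injective (Subtype.ext h)

theorem tp2_segmentCopy (f : S 1 ≃[L] S 2) (g : S 1 ≃[L] S 3) (k : Fin 3) (p q : S 1) :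
    tp2 (L := L) (segmentCopy f g k p) (segmentCopy f g k q) = tp2 (p : A) (q : A) := by
  fin_cases k
  · rfl
  · exact tp2_equiv f p q
  · exact tp2_equiv g p q

/-- The `2`-types between two of the three segments do not depend on the segments. -/
theorem tp2_segmentCopy_lt {f : S 1 ≃[L] S 2} {g : S 1 ≃[L] S 3}
    (h12 : Transferred f (g.comp f.symm))
    (h02 : Transferred (FirstOrder.Language.Equiv.refl L (S 1)) (g.comp f.symm)) {j k : Fin 3}
    (hjk : j < k) (p q : S 1) :
    tp2 (L := L) (segmentCopy f g j p) (segmentCopy f g k q) = tp2 (p : A) (f q : A) := by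
  have hgf : g.comp f.symm (f q) = g q := by
    rw [FirstOrder.Language.Equiv.comp_apply, FirstOrder.Language.Equiv.symm_apply_apply]
  have e1 := h12 p (f q)
  have e2 := h02 p (f q)
  rw [hgf] at e1 e2
  fin_cases j <;> fin_cases k <;> first | exact absurd hjk (by decide) | skip
  · rfl
  · exact e2.symm
  · exact e1.symm

/-- A structure with three equivalent segments in which each of the first two segments finds its
witnesses in the base or in the next segment gives rise to a model, in which the segment is
repeated infinitely often. Three elements of the model always embed into the given structure. -/
theorem isModel_of_segments (hL : IsUnaryBinary L) {T : L.Relations 2} {Ψ : NormalForm L}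
    (hS : IsPartition S) (hE : EquivalentConnections L S) (h0 : ∀ a b : A, Holds Ψ.ψ₀.1 a b)
    (hT : TransOn T A)
    (hγ : ∀ j : Fin 3, ∀ a ∈ S j.castSucc, ∀ i : Fin Ψ.m,
      Ψ.W T i a ∩ S 0 = ∅ → (Ψ.W T i a ∩ S j.succ).Nonempty)
    (hδ : ∀ a : A, ∀ i : Fin Ψ.m', ∃ b ∈ clique T a, Holds (Ψ.δ T i) a b) : Ψ.Satisfiable T := by
  classical
  obtain ⟨f, g, h01, h02, h12, h13⟩ := hE
  obtain ⟨hne, hdisj, hcover⟩ := hS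
  have hd : ∀ {j k : Fin 4} {a : A}, a ∈ S j → a ∈ S k → j = k := fun {j k a} hj hk =>
    by_contra fun h => Set.disjoint_left.1 (hdisj j k h) hj hk
  have hbase : ∀ (k : Fin 3) (a : S 0) (p : S 1),
      tp2 (L := L) (a : A) (segmentCopy f g k p) = tp2 (a : A) (p : A) := by
    intro k a p
    fin_cases k
    · rfl
    · exact (h01 a p).symm
    · exact (h02 a p).symm
  let o : S 0 ⊕ (S 1 × ℕ) → A := Sum.elim (fun a => a) (fun p => p.1)
  let pr : S 0 ⊕ (S 1 × ℕ) → S 0 ⊕ (S 1 × ℕ) → A × A := fun e e' =>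
    match e, e' with
    | .inl a, .inl b => (a, b)
    | .inl a, .inr p => (a, p.1)
    | .inr p, .inl a => (p.1, a)
    | .inr p, .inr q =>
      if p.2 = q.2 then (p.1, q.1) else if p.2 < q.2 then (p.1, f q.1) else (f p.1, q.1)
  have hdiag : ∀ e, pr e e = (o e, o e) := by
    rintro (a | p)
    · rfl
    · simp [pr, o]
  have hswap : ∀ e e', pr e' e = (pr e e').swap := by
    rintro (a | p) (b | q)
    · rfl
    · rfl
    · rfl
    · simp only [pr]
      rcases lt_trichotomy p.2 q.2 with h | h | h
      · rw [if_neg h.ne', if_neg h.le.not_gt, if_neg h.ne, if_pos h, Prod.swap_prod_mk]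
      · rw [if_pos h.symm, if_pos h, Prod.swap_prod_mk]
      · rw [if_neg h.ne, if_pos h, if_neg h.ne', if_neg h.le.not_gt, Prod.swap_prod_mk]
  have htp : ∀ e e', tp1 (L := L) (pr e e').1 = tp1 (o e) := by
    rintro (a | p) (b | q)
    · rfl
    · rfl
    · rfl
    · simp only [pr]
      split_ifs
      · rfl
      · rfl
      · exact tp2_fst (tp2_equiv f p.1 p.1)
  obtain ⟨N, h1, h2⟩ := exists_structure_of_pairs (L := L) o pr hdiag hswap htp
  -- Any three elements of the new structure embed into `A`.
  have hemb : ∀ e₁ e₂ e₃ : S 0 ⊕ (S 1 × ℕ), ∃ E : S 0 ⊕ (S 1 × ℕ) → A,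
      ∀ e ∈ ({e₁, e₂, e₃} : Set (S 0 ⊕ (S 1 × ℕ))), ∀ e' ∈ ({e₁, e₂, e₃} : Set (S 0 ⊕ (S 1 × ℕ))),
        tp2 (L := L) e e' = tp2 (E e) (E e') ∧ (e = e' ↔ E e = E e') := by
    intro e₁ e₂ e₃
    let lev : S 0 ⊕ (S 1 × ℕ) → ℕ := Sum.elim (fun _ => 0) Prod.snd
    obtain ⟨r, hr⟩ := exists_rank (lev e₁) (lev e₂) (lev e₃)
    have hlev : ∀ e ∈ ({e₁, e₂, e₃} : Set (S 0 ⊕ (S 1 × ℕ))),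
        lev e ∈ ({lev e₁, lev e₂, lev e₃} : Finset ℕ) := by
      rintro e (rfl | rfl | rfl) <;> simp
    refine ⟨Sum.elim (fun a => a) (fun p => segmentCopy f g (r p.2) p.1), ?_⟩
    intro e he e' he'
    replace he := hlev e he
    replace he' := hlev e' he'
    rw [h2]
    rcases e with a | ⟨p, j⟩ <;> rcases e' with b | ⟨q, k⟩
    · exact ⟨rfl, ⟨fun h => congrArg Subtype.val (Sum.inl.inj h),
        fun h => congrArg Sum.inl (Subtype.ext h)⟩⟩
    · refine ⟨(hbase _ a q).symm, iff_of_false (by simp) fun h => ?_⟩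
      have h : (a : A) = segmentCopy f g (r k) q := h
      exact Fin.succ_ne_zero _ (hd (segmentCopy_mem f g (r k) q) (h ▸ a.2))
    · refine ⟨(tp2_swap (hbase _ b p)).symm, iff_of_false (by simp) fun h => ?_⟩
      have h : segmentCopy f g (r j) p = b := h
      exact Fin.succ_ne_zero _ (hd (segmentCopy_mem f g (r j) p) (h ▸ b.2))
    · simp only [pr, Sum.elim_inr, Sum.inr.injEq, Prod.mk.injEq]
      have hrne : r j ≠ r k → segmentCopy f g (r j) p ≠ segmentCopy f g (r k) q := fun hne h =>
        hne (Fin.succ_injective _ (hd (segmentCopy_mem f g (r j) p)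
          (h ▸ segmentCopy_mem f g (r k) q)))
      rcases lt_trichotomy j k with h | h | h
      · have hlt := hr j he k he' h
        rw [if_neg h.ne, if_pos h]
        exact ⟨(tp2_segmentCopy_lt h12 h13 hlt p q).symm,
          iff_of_false (fun hc => h.ne hc.2) (hrne hlt.ne)⟩
      · subst h
        rw [if_pos rfl]
        exact ⟨(tp2_segmentCopy f g _ p q).symm, ⟨fun h => h.1 ▸ rfl,
          fun h => ⟨segmentCopy_injective f g _ h, rfl⟩⟩⟩
      · have hlt := hr k he' j he h
        rw [if_neg h.ne', if_neg h.le.not_gt]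
        exact ⟨(tp2_swap (tp2_segmentCopy_lt h12 h13 hlt q p)).symm,
          iff_of_false (fun hc => h.ne' hc.2) (hrne hlt.ne')⟩
  refine ⟨_, N, ?_, (Ψ.isModel_iff T _).2 ⟨?_, ?_, ?_, ?_⟩⟩
  · obtain ⟨a, ha⟩ := hne 0
    exact ⟨.inl ⟨a, ha⟩⟩
  · intro e₁ e₂ e₃ h h'
    obtain ⟨E, hE⟩ := hemb e₁ e₂ e₃
    rw [tp2_rel (hE e₁ (by simp) e₂ (by simp)).1] at h
    rw [tp2_rel (hE e₂ (by simp) e₃ (by simp)).1] at h'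
    rw [tp2_rel (hE e₁ (by simp) e₃ (by simp)).1]
    exact hT _ _ _ h h'
  · intro e₁ e₂
    obtain ⟨E, hE⟩ := hemb e₁ e₂ e₂
    have h := hE e₁ (by simp) e₂ (by simp)
    exact (holds_iff hL h.2 h.1 Ψ.ψ₀.2).2 (h0 _ _)
  · intro i e
    -- Every copy of the segment finds its witnesses as the first segment does.
    have hw : ∀ j : Fin 3, ∀ a ∈ S j.castSucc, ∃ b, Holds (Ψ.γ T i) a b ∧
        (b ∈ S 0 ∨ b ∈ S j.succ) := by
      intro j a ha
      by_cases h : Ψ.W T i a ∩ S 0 = ∅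
      · obtain ⟨b, hb, hbS⟩ := hγ j a ha i h
        exact ⟨b, hb.1, Or.inr hbS⟩
      · obtain ⟨b, hb, hbS⟩ := Set.nonempty_iff_ne_empty.2 h
        exact ⟨b, hb.1, Or.inl hbS⟩
    have hmk : ∀ {e e' : S 0 ⊕ (S 1 × ℕ)} {x y : A}, e ≠ e' →
        tp2 (L := L) x y = tp2 (pr e e').1 (pr e e').2 →
        Holds (Ψ.γ T i) x y → Holds (Ψ.γ T i) e e' := by
      intro e e' x y hne ht h
      exact (holds_iff hL (iff_of_false hne (NormalForm.ne_of_holds_γ h)) ((h2 e e').trans ht.symm)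
        (Ψ.isQF_γ T i)).2 h
    rcases e with a | ⟨p, j⟩
    · obtain ⟨b, hb, hbS | hbS⟩ := hw 0 a a.2
      · refine ⟨.inl ⟨b, hbS⟩, hmk (fun h => ?_) rfl hb⟩
        exact NormalForm.ne_of_holds_γ hb (congrArg Subtype.val (Sum.inl.inj h))
      · exact ⟨.inr (⟨b, hbS⟩, 0), hmk (by simp) rfl hb⟩
    · obtain ⟨b, hb, hbS | hbS⟩ := hw 1 p p.2
      · exact ⟨.inl ⟨b, hbS⟩, hmk (by simp) rfl hb⟩
      · obtain ⟨q, rfl⟩ := exists_segmentCopy_eq f g (k := 1) hbS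
        refine ⟨.inr (q, j + 1), hmk (by simp) ?_ hb⟩
        simp only [pr]
        rw [if_neg (Nat.lt_succ_self j).ne, if_pos (Nat.lt_succ_self j)]
        rfl
  · intro i e
    have hmk : ∀ {e e' : S 0 ⊕ (S 1 × ℕ)} {x y : A}, (e = e' ↔ x = y) →
        tp2 (L := L) x y = tp2 (pr e e').1 (pr e e').2 →
        Holds (Ψ.δ T i) x y → Holds (Ψ.δ T i) e e' := by
      intro e e' x y heq ht h
      exact (holds_iff hL heq ((h2 e e').trans ht.symm) (Ψ.isQF_δ T i)).2 h
    have hcase : ∀ b : A, b ∈ S 0 ∨ ∃ k : Fin 3, b ∈ S k.succ := by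
      intro b
      obtain ⟨k, hk⟩ := Set.mem_iUnion.1 (hcover ▸ Set.mem_univ b)
      rcases Fin.eq_zero_or_eq_succ k with rfl | ⟨k, rfl⟩
      · exact Or.inl hk
      · exact Or.inr ⟨k, hk⟩
    have hne0 : ∀ {k : Fin 3} {a b : A}, a ∈ S 0 → b ∈ S k.succ → a ≠ b := by
      rintro k a b ha hb rfl
      exact Fin.succ_ne_zero _ (hd hb ha)
    obtain ⟨b, -, hb⟩ := hδ (o e) i
    rcases e with a | ⟨p, j⟩
    · rcases hcase b with hbS | ⟨k, hbS⟩
      · exact ⟨.inl ⟨b, hbS⟩, hmk ⟨fun h => congrArg Subtype.val (Sum.inl.inj h),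
          fun h => congrArg Sum.inl (Subtype.ext h)⟩ rfl hb⟩
      · obtain ⟨q, rfl⟩ := exists_segmentCopy_eq f g hbS
        exact ⟨.inr (q, 0), hmk (iff_of_false (by simp) (hne0 a.2 hbS)) (hbase k a q) hb⟩
    · rcases hcase b with hbS | ⟨k, hbS⟩
      · exact ⟨.inl ⟨b, hbS⟩, hmk (iff_of_false (by simp)
          (hne0 (k := 0) hbS p.2).symm) rfl hb⟩
      · obtain ⟨q, rfl⟩ := exists_segmentCopy_eq f g hbS
        by_cases hk : k = 0
        · subst hk
          refine ⟨.inr (q, j), hmk ?_ ?_ hb⟩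
          · simp only [Sum.inr.injEq, Prod.mk.injEq, and_true]
            exact Subtype.ext_iff
          · simp only [pr, if_true]
            rfl
        · have hk0 : 0 < k := Fin.pos_iff_ne_zero.2 hk
          refine ⟨.inr (q, j + 1), hmk (iff_of_false (by simp) fun h => ?_) ?_ hb⟩
          · have h : segmentCopy f g 0 p = segmentCopy f g k q := h
            exact hk0.ne (Fin.succ_injective _ (hd (segmentCopy_mem f g 0 p) (h ▸ hbS)))
          · simp only [pr]
            rw [if_neg (Nat.lt_succ_self j).ne, if_pos (Nat.lt_succ_self j)]
            exact tp2_segmentCopy_lt h12 h13 hk0 p q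

end Repeat

end TransWit

theorem mainTheorem2 :
    ∃ p q : Polynomial ℕ,
      ∀ (L : FirstOrder.Language.{0, 0}) [L.IsRelational] [Finite (Σ n, L.Relations n)],
        TransWit.IsUnaryBinary L → ∀ (T : L.Relations 2) (Ψ : TransWit.NormalForm L) (h : ℕ),
        h = 2 ^ p.eval (TransWit.sigSize L) →
        -- `h` is a bound on the size of cliques
        (Ψ.Satisfiable T → ∃ (A : Type) (_ : L.Structure A), Nonempty A ∧ Ψ.IsModel T A ∧
          TransWit.CliquesBounded T h A) ∧
        -- `𝕄` is doubly exponential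
        Ψ.segBound T h ≤ (Ψ.m + 1) * 2 ^ (2 ^ q.eval (TransWit.sigSize L)) ∧
        -- the characterization of satisfiability
        (Ψ.Satisfiable T ↔
          ∃ (A : Type) (_ : L.Structure A) (S : Fin 4 → Set A),
            Nonempty A ∧
            (Finite A ∧ Nat.card A ≤ 4 * Ψ.segBound T h) ∧
            ((S 0 = Set.univ ∧ S 1 = ∅ ∧ S 2 = ∅ ∧ S 3 = ∅) ∨
              (TransWit.IsPartition S ∧ TransWit.EquivalentConnections L S)) ∧
            (∀ a b : A, TransWit.Holds Ψ.ψ₀.1 a b) ∧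
            TransWit.TransOn T A ∧
            (∀ j : Fin 3, ∀ a ∈ S j.castSucc, ∀ i : Fin Ψ.m,
              Ψ.W T i a ∩ S 0 = ∅ → (Ψ.W T i a ∩ S j.succ).Nonempty) ∧
            (∀ a : A, ∀ i : Fin Ψ.m', ∃ b ∈ TransWit.clique T a,
              TransWit.Holds (Ψ.δ T i) a b)) := by
  refine ⟨13 * Polynomial.X + 3, 27 * Polynomial.X + 9, ?_⟩
  intro L _ _ hL T Ψ h hh
  have hp : ∀ n : ℕ, (13 * Polynomial.X + 3 : Polynomial ℕ).eval n = 13 * n + 3 := by simp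
  have hq : ∀ n : ℕ, (27 * Polynomial.X + 9 : Polynomial ℕ).eval n = 27 * n + 9 := by simp
  rw [hp] at hh
  rw [hq]
  have hsmall : Ψ.Satisfiable T → ∃ (A : Type) (_ : L.Structure A), Nonempty A ∧ Ψ.IsModel T A ∧
      TransWit.CliquesBounded T h A := by
    rintro ⟨A, _, _, hA⟩
    rw [hh]
    exact TransWit.exists_model_cliquesBounded hL hA
  refine ⟨hsmall, hh ▸ TransWit.segBound_le hL T Ψ, fun hsat => ?_, ?_⟩
  · obtain ⟨A, _, _, hA, hb⟩ := hsmall hsat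
    exact TransWit.exists_segments hL hA hb
  · rintro ⟨A, _, S, hA, -, ⟨hS0, hS1, -, -⟩ | ⟨hS, hE⟩, h0, hT, hγ, hδ⟩
    · refine ⟨A, _, hA, (Ψ.isModel_iff T A).2 ⟨hT, h0, fun i a => ?_, fun i a => ?_⟩⟩
      · have hne : (Ψ.W T i a ∩ S 0).Nonempty := by
          by_contra hc
          obtain ⟨b, -, hb⟩ := hγ 0 a (hS0 ▸ Set.mem_univ a) i (Set.not_nonempty_iff_eq_empty.1 hc)
          exact Set.notMem_empty b (hS1 ▸ hb)
        obtain ⟨b, hb, -⟩ := hne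
        exact ⟨b, hb.1⟩
      · obtain ⟨b, -, hb⟩ := hδ a i
        exact ⟨b, hb⟩
    · exact TransWit.isModel_of_segments hL hS hE h0 hT hγ hδ
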